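/- **Setting.** Let $p_1\in\mathbb C$, and for $n_1,n\in\mathbb Z$, $x_1\in\mathbb R$, put $$\rho_n(k)=e^{kx_1}\Big(\frac{p_1+k}{p_1-k}\Big)^{n_1}k^n,\qquad \sigma_n(k')=e^{k'x_1}\Big(\frac{p_1+k'}{p_1-k'}\Big)^{n_1}(-k')^{-n},\qquad \Omega(k,k')=\frac1{k+k'} .$$ Let $\mathbf c(k)$ and ${}^t\mathbf c(k')$ be the infinite column and row vectors with $i$-th components $k^i$ and $k'^i$, $i\in\mathbb Z$. Let $D\subset\mathbb C\times\mathbb C$ be a measurable domain and $d\zeta=w\,d\mu$ a complex measure with density $w$ with respect to a $\sigma$-finite measure $\mu$. Let $J\subset\mathbb R$ be a non-empty open interval. Suppose that for $(k,k')\in D$ the numbers $k$ and $k'$ are non-zero and stay at a positive distance from $\pm p_1$, that $|k+l'|$ is bounded below by a positive constant for $(k,k'),(l,l')\in D$, and that for all $n_1,n,i,j\in\mathbb Z$ and $x_1\in J$ the integral $\iint_D d\zeta(k,k')\,\rho_n(k)k^ik'^j\sigma_n(k')$ converges absolutely; it is the $(i,j)$ entry of $\mathbf C_n=\iint_D d\zeta(k,k')\,\rho_n(k)\mathbf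 c(k)\,{}^t\mathbf c(k')\sigma_n(k')$. Let $$\tau_n=\det(1+\mathbf\Omega\mathbf C_n)=\sum_{r\ge0}\frac1{r!}\int_{D^r}\det\big[\rho_n(k_i)\,\Omega(k_i,k'_j)\,\sigma_n(k'_j)\big]_{i,j=1}^r\ d\zeta(k_1,k'_1)\cdots d\zeta(k_r,k'_r),$$ where $\mathbf\Omega$ is defined formally by ${}^t\mathbf c(k')\mathbf\Omega\,\mathbf c(k)=\Omega(k,k')$, and suppose that $\tau_n\ne0$ for all $n_1,n\in\mathbb Z$ and $x_1\in J$. Let $K\subset\mathbb C\setminus\{0,p_1,-p_1\}$ contain all $k'$ with $(k,k')\in D$ for some $k$, and suppose that for each $k'\in K$ the numbers $|l+k'|$, $(l,l')\in D$, are bounded below by a positive constant. Suppose that for all $n_1,n\in\mathbb Z$ and $x_1\in J$ the infinite row vectors ${}^t\mathbf v_n(k')$, $k'\in K$, with components indexed by $\mathbb Z$, solve the adjoint linear integral equation $${}^t\mathbf v_n(k')+\iint_D d\zeta(l,l')\,\rho_n(l)\,\Omega(l,k')\,\sigma_n(k')\,{}^t\mathbf v_n(l')={}^t\mathbf c(k')\,\sigma_n(k'),\qquad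 k'\in K,$$ and let $\mathbf U_n=\iint_D d\zeta(k,k')\,\rho_n(k)\,\mathbf c(k)\,{}^t\mathbf v_n(k')$, all these integrals converging absolutely. Put $\psi_n=[{}^t\mathbf v_n(k')]^{(0)}$ and $u_n=\mathbf U_n^{(0,0)}$. Let tilde and undertilde denote the shifts $n_1\mapsto n_1+1$ and $n_1\mapsto n_1-1$, with $\underset{\sim}{u}{}_{n}$ standing for $u_n$ at $n_1-1$, and let $\partial_1=\partial/\partial x_1$. **Theorem.** On $J$ one has $u_n=\partial_1\ln\tau_n$ for a differentiable choice $\ln\tau_n$ of the logarithm. With $\partial_1^{-1}u_n:=\ln\tau_n$, extended linearly, the following holds for all $n_1,n\in\mathbb Z$, $x_1\in J$. (1) For every $k'\in K$, $\psi_n$ is differentiable in $x_1$ and satisfies the adjoint Lax pair $$\partial_1\psi_n=-\psi_{n-1}+(u_{n-1}-u_n)\psi_n,$$ $$\underset{\sim}{\psi}{}_{n-1}=\frac{2p_1+\underset{\sim}{u}{}_{n-1}-u_{n-1}}{1+\exp\big[\partial_1^{-1}(\underset{\sim}{u}{}_{n-1}-u_{n-1})-\partial_1^{-1}(\underset{\sim}{u}{}_n-u_n)\big]}\,\underset{\sim}{\psi}{}_n-\psi_{n-1}-\frac{2p_1+\underset{\sim}{u}{}_{n-1}-u_{n-1}}{1+\exp\big[\partial_1^{-1}(u_{n-1}-\underset{\sim}{u}{}_{n-1})-\partial_1^{-1}(u_n-\underset{\sim}{u}{}_n)\big]}\,\psi_n,$$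 the second relation wherever its denominators do not vanish. (2) This pair of linear equations is not gauge equivalent to the standard Lax pair $$\partial_1\phi_n=\phi_{n+1}+(u_{n+1}-u_n)\phi_n,$$ $$\widetilde\phi_{n+1}=\frac{2p_1+u_{n+1}-\widetilde u_{n+1}}{1+\exp\big[\partial_1^{-1}(\widetilde u_{n+1}-u_{n+1})-\partial_1^{-1}(\widetilde u_n-u_n)\big]}\,\widetilde\phi_n-\phi_{n+1}-\frac{2p_1+u_{n+1}-\widetilde u_{n+1}}{1+\exp\big[\partial_1^{-1}(u_{n+1}-\widetilde u_{n+1})-\partial_1^{-1}(u_n-\widetilde u_n)\big]}\,\phi_n$$ (again wherever the denominators do not vanish): there is no nowhere vanishing function $g_n(x_1,n_1)$ on $\mathbb Z\times J\times\mathbb Z$, differentiable in $x_1$, such that for all functions $\phi$ of $(n_1,n,x_1)$, $\phi$ satisfies the first (respectively second) equation of the standard pair for all $n_1,n\in\mathbb Z$, $x_1\in J$ if and only if $g\phi$ satisfies the first (respectively second) equation of the adjoint pair there. -/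

import Mathlib

open MeasureTheory

noncomputable section

namespace DL

/-- The discrete-continuous plane wave factor
`ρ_n(k) = exp(k x₁) ((p₁ + k)/(p₁ - k))^{n₁} k^n`. -/
def rho (p : ℂ) (m n : ℤ) (x : ℝ) (k : ℂ) : ℂ :=
  Complex.exp (k * x) * ((p + k) / (p - k)) ^ m * k ^ n

/-- The plane wave factor
`σ_n(k') = exp(k' x₁) ((p₁ + k')/(p₁ - k'))^{n₁} (-k')^{-n}`. -/
def sigma (p : ℂ) (m n : ℤ) (x : ℝ) (k' : ℂ) : ℂ :=
  Complex.exp (k' * x) * ((p + k') / (p - k')) ^ m * (-k') ^ (-n)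

/-- The Cauchy kernel `Ω(k, k') = 1/(k + k')`. -/
def Omega (k k' : ℂ) : ℂ := 1 / (k + k')

/-- The `i`-th component, `i ∈ ℤ`, of the infinite vectors `c(k)` and `ᵗc(k')`. -/
def cVec (k : ℂ) (i : ℤ) : ℂ := k ^ i

/-- An integration domain `D` in the space of pairs `(k, k')` of spectral parameters together
with a complex measure `dζ = w dμ` given by a density `w` with respect to a positive measure. -/
structure SpectralMeasure where
  /-- the integration domain -/
  D : Set (ℂ × ℂ)
  /-- the positive reference measure -/
  μ : Measure (ℂ × ℂ)
  /-- the complex density -/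
  w : ℂ × ℂ → ℂ

/-- `∬_D dζ(k, k') f(k, k')` converges absolutely. -/
def SpectralMeasure.Converges (ζ : SpectralMeasure) (f : ℂ × ℂ → ℂ) : Prop :=
  IntegrableOn (fun z => ζ.w z * f z) ζ.D ζ.μ

/-- `∬_D dζ(k, k') f(k, k')`. -/
def SpectralMeasure.integral (ζ : SpectralMeasure) (f : ℂ × ℂ → ℂ) : ℂ :=
  ∫ z in ζ.D, ζ.w z * f z ∂ζ.μ

/-- The integrals of the theory make sense for `x₁ ∈ J`: the domain keeps away from the
singularities of the plane wave factors and of the Cauchy kernel, and every entry of the infinite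
matrix `C_n = ∬_D dζ(k, k') ρ_n(k) c(k) ᵗc(k') σ_n(k')` converges absolutely. -/
structure Admissible (p : ℂ) (ζ : SpectralMeasure) (J : Set ℝ) : Prop where
  measurableSet : MeasurableSet ζ.D
  ne_zero : ∀ z ∈ ζ.D, z.1 ≠ 0 ∧ z.2 ≠ 0
  separated_p : ∃ δ > 0, ∀ z ∈ ζ.D,
    δ ≤ ‖z.1 - p‖ ∧ δ ≤ ‖z.1 + p‖ ∧ δ ≤ ‖z.2 - p‖ ∧ δ ≤ ‖z.2 + p‖
  separated : ∃ δ > 0, ∀ z ∈ ζ.D, ∀ z' ∈ ζ.D, δ ≤ ‖z.1 + z'.2‖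
  converges : ∀ m n : ℤ, ∀ x ∈ J, ∀ i j : ℤ, ζ.Converges fun z =>
    rho p m n x z.1 * cVec z.1 i * cVec z.2 j * sigma p m n x z.2

/-- `K` is a set of values of the spectral parameter `k'` of the adjoint wave function: it
contains those that occur in `D`, and on it `σ_n(k')` and the kernel are regular. -/
structure SpectralRange (p : ℂ) (ζ : SpectralMeasure) (K : Set ℂ) : Prop where
  contains : Prod.snd '' ζ.D ⊆ K
  ne : ∀ k' ∈ K, k' ≠ 0 ∧ k' ≠ p ∧ k' ≠ -p
  separated : ∀ k' ∈ K, ∃ δ > 0, ∀ z ∈ ζ.D, δ ≤ ‖z.1 + k'‖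

/-- The tau function `τ_n = det(1 + Ω C_n)`, as its expansion
`1 + ∑_i (ΩC_n)^{(i,i)} + ∑_{i<j} |…| + ⋯`. The sum of the principal `r × r` minors of `Ω C_n`,
a polynomial in the traces `tr (ΩC_n)^s`, is written through `ζ` by means of
`ᵗc(k') Ω c(k) = Ω(k, k')`, which turns the expansion into the Fredholm determinant
`∑_r (1/r!) ∫ ⋯ ∫ det[ρ_n(k_i) Ω(k_i, k'_j) σ_n(k'_j)] dζ(k_1, k'_1) ⋯ dζ(k_r, k'_r)`. -/
def tau (p : ℂ) (ζ : SpectralMeasure) (m n : ℤ) (x : ℝ) : ℂ :=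
  ∑' r : ℕ, (1 / (r.factorial : ℂ)) *
    ∫ z : Fin r → ℂ × ℂ,
      (∏ i, ζ.w (z i)) *
        (Matrix.of fun i j : Fin r =>
          rho p m n x (z i).1 * Omega (z i).1 (z j).2 * sigma p m n x (z j).2).det
      ∂(Measure.pi fun _ : Fin r => ζ.μ.restrict ζ.D)

/-- The entry `U_n^{(i,j)}` of the infinite potential matrix
`U_n = ∬_D dζ(k, k') ρ_n(k) c(k) ᵗv_n(k')`; here `v m n x k' j` is the `j`-th component of
`ᵗv_n(k')` at `n₁ = m`, `x₁ = x`. -/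
def potential (p : ℂ) (ζ : SpectralMeasure) (v : ℤ → ℤ → ℝ → ℂ → ℤ → ℂ)
    (i j : ℤ) (m n : ℤ) (x : ℝ) : ℂ :=
  ζ.integral fun z => rho p m n x z.1 * cVec z.1 i * v m n x z.2 j

/-- The infinite row vectors `ᵗv_n(k')`, `k' ∈ K`, solve the adjoint linear integral equation
`ᵗv_n(k') + ∬_D dζ(l, l') ρ_n(l) Ω(l, k') σ_n(k') ᵗv_n(l') = ᵗc(k') σ_n(k')`
for all `n₁`, `n` and `x₁ ∈ J`, where the integrals in the equation and in the potential matrix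
converge absolutely. -/
structure IsAdjointSolution (p : ℂ) (ζ : SpectralMeasure) (J : Set ℝ) (K : Set ℂ)
    (v : ℤ → ℤ → ℝ → ℂ → ℤ → ℂ) : Prop where
  converges_potential : ∀ m n : ℤ, ∀ x ∈ J, ∀ i j : ℤ, ζ.Converges fun z =>
    rho p m n x z.1 * cVec z.1 i * v m n x z.2 j
  converges : ∀ m n : ℤ, ∀ x ∈ J, ∀ k' ∈ K, ∀ j : ℤ, ζ.Converges fun z =>
    rho p m n x z.1 * Omega z.1 k' * sigma p m n x k' * v m n x z.2 j
  equation : ∀ m n : ℤ, ∀ x ∈ J, ∀ k' ∈ K, ∀ j : ℤ,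
    v m n x k' j +
        ζ.integral (fun z =>
          rho p m n x z.1 * Omega z.1 k' * sigma p m n x k' * v m n x z.2 j) =
      cVec k' j * sigma p m n x k'

/-- Scalar functions of `(n₁, n, x₁)`. -/
abbrev LatticeFun : Type := ℤ → ℤ → ℝ → ℂ

/-- `S = ∂₁⁻¹ u`, with the integration constants fixed by `∂₁⁻¹ u_n = ln τ_n`. -/
structure IsInverseDerivative (J : Set ℝ) (τ u S : LatticeFun) : Prop where
  hasDerivAt : ∀ m n : ℤ, ∀ x ∈ J, HasDerivAt (S m n) (u m n x) x
  exp_eq : ∀ m n : ℤ, ∀ x ∈ J, Complex.exp (S m n x) = τ m n x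

/-- `∂₁ φ_n = φ_{n+1} + (u_{n+1} - u_n) φ_n`. -/
def LaxA (J : Set ℝ) (u φ : LatticeFun) : Prop :=
  ∀ m n : ℤ, ∀ x ∈ J,
    HasDerivAt (φ m n) (φ m (n + 1) x + (u m (n + 1) x - u m n x) * φ m n x) x

/-- The forward `n₁`-shift relation of the standard Lax pair, at all points at which its
denominators do not vanish; `S` stands for `∂₁⁻¹ u`. -/
def LaxB (p : ℂ) (J : Set ℝ) (u S φ : LatticeFun) : Prop :=
  ∀ m n : ℤ, ∀ x ∈ J,
    1 + Complex.exp ((S (m + 1) (n + 1) x - S m (n + 1) x) - (S (m + 1) n x - S m n x)) ≠ 0 →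
    1 + Complex.exp ((S m (n + 1) x - S (m + 1) (n + 1) x) - (S m n x - S (m + 1) n x)) ≠ 0 →
    φ (m + 1) (n + 1) x =
      (2 * p + u m (n + 1) x - u (m + 1) (n + 1) x) /
          (1 + Complex.exp
            ((S (m + 1) (n + 1) x - S m (n + 1) x) - (S (m + 1) n x - S m n x))) *
        φ (m + 1) n x
      - φ m (n + 1) x
      - (2 * p + u m (n + 1) x - u (m + 1) (n + 1) x) /
          (1 + Complex.exp
            ((S m (n + 1) x - S (m + 1) (n + 1) x) - (S m n x - S (m + 1) n x))) *
        φ m n x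

/-- `∂₁ ψ_n = -ψ_{n-1} + (u_{n-1} - u_n) ψ_n`. -/
def AdLaxA (J : Set ℝ) (u ψ : LatticeFun) : Prop :=
  ∀ m n : ℤ, ∀ x ∈ J,
    HasDerivAt (ψ m n) (-ψ m (n - 1) x + (u m (n - 1) x - u m n x) * ψ m n x) x

/-- The backward `n₁`-shift relation of the adjoint Lax pair, at all points at which its
denominators do not vanish; `S` stands for `∂₁⁻¹ u`. -/
def AdLaxB (p : ℂ) (J : Set ℝ) (u S ψ : LatticeFun) : Prop :=
  ∀ m n : ℤ, ∀ x ∈ J,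
    1 + Complex.exp ((S (m - 1) (n - 1) x - S m (n - 1) x) - (S (m - 1) n x - S m n x)) ≠ 0 →
    1 + Complex.exp ((S m (n - 1) x - S (m - 1) (n - 1) x) - (S m n x - S (m - 1) n x)) ≠ 0 →
    ψ (m - 1) (n - 1) x =
      (2 * p + u (m - 1) (n - 1) x - u m (n - 1) x) /
          (1 + Complex.exp
            ((S (m - 1) (n - 1) x - S m (n - 1) x) - (S (m - 1) n x - S m n x))) *
        ψ (m - 1) n x
      - ψ m (n - 1) x
      - (2 * p + u (m - 1) (n - 1) x - u m (n - 1) x) /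
          (1 + Complex.exp
            ((S m (n - 1) x - S (m - 1) (n - 1) x) - (S m n x - S (m - 1) n x))) *
        ψ m n x

/-- Two pairs of linear equations for a scalar wave function are gauge equivalent if there is a
nowhere vanishing gauge function `g`, differentiable in `x₁`, such that `φ ↦ g φ` carries each
equation of the first pair into the corresponding equation of the second. -/
def GaugeEquivalent (J : Set ℝ) (A B A' B' : LatticeFun → Prop) : Prop :=
  ∃ g : LatticeFun,
    (∀ m n : ℤ, ∀ x ∈ J, g m n x ≠ 0 ∧ DifferentiableAt ℝ (g m n) x) ∧
    (∀ φ : LatticeFun, A φ ↔ A' fun m n x => g m n x * φ m n x) ∧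
    (∀ φ : LatticeFun, B φ ↔ B' fun m n x => g m n x * φ m n x)

end DL

end

/-! Divided by its plane wave, the adjoint wave function becomes an amplitude V = ψ/σ (`amplitude`)
with V(κ) = 1 - ∬ w V(k')/(k+κ), where w is the density of ζ times ρ(k)σ(k'). The tau function is
the Fredholm determinant of this equation.

The analytic core is Cramer's rule for Fredholm series (`fredholm_cramer`), all series being
controlled by Hadamard's inequality. If φ = wV solves the equation with constant right-hand side c,
then τ ∫ φ f is c times the series of Cauchy determinants with one column replaced by f. Each use is
a choice of c and f: c = 0 and f = 1/(k+κ): as τ ≠ 0, the homogeneous equation has only the zero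
solution (`homogeneous_eq_zero`); c = 1 and f = 1: the series is ∂₁τ, so ∂₁τ = τu
(`tau_mul_potential`); c = 1 and f = 1/k: the ratio τ_{n-1}/τ_n is 1 - ∬ wV/k (`tau_sub_one_right`);
c = 1 and f = 1/(k+κ): τV(κ) is itself a Fredholm series, so V is differentiable in x₁, with bounds
that permit differentiation under the integral (`amplitude_deriv_bound`).

Both adjoint Lax equations then come from uniqueness. For the x₁-equation the defect solves the
homogeneous equation (`hasDerivAt_amplitude`). For the n₁-shift, partial fractions leave a
right-hand side θ·2p/(p+κ) with an unknown constant θ; the moment against 1/k, known from the tau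
ratios, forces θ = 0 (`amplitude_relation`).

Gauge equivalence already fails for the first equations. The standard one couples n to n+1 and has a
solution that vanishes for n > 0 but not at n = 0. A gauge factor keeps this support, while the
adjoint equation at n = 1 would force the value at n = 0 to vanish. -/

namespace Matrix

/-! ### Determinant identities and Hadamard's inequality. -/

theorem det_eq_border {R : Type*} [CommRing R] {r : ℕ} (M : Matrix (Fin (r + 1)) (Fin (r + 1)) R) :
    M.det = M 0 0 * (M.submatrix Fin.succ Fin.succ).det -
      ∑ j, M 0 j.succ * ((M.submatrix Fin.succ Fin.succ).updateCol j fun i => M i.succ 0).det := by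
  rw [det_succ_row_zero, Fin.sum_univ_succ, sub_eq_add_neg, ← Finset.sum_neg_distrib]
  congr 1
  · simp [Fin.succAbove_zero]
  · refine Finset.sum_congr rfl fun j _ => ?_
    obtain _ | r := r
    · exact j.elim0
    -- The minor of M that omits row 0 and column j+1 and the matrix with replaced column j contain
    -- the same columns in different order. Expanding each along the column taken from M's column 0
    -- produces identical minors, so only signs remain to be compared.
    · rw [det_succ_column_zero, det_succ_column _ j, Finset.mul_sum, Finset.mul_sum,
        ← Finset.sum_neg_distrib]
      refine Finset.sum_congr rfl fun i _ => ?_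
      have h : ((M.submatrix Fin.succ j.succ.succAbove).submatrix i.succAbove Fin.succ) =
          (((M.submatrix Fin.succ Fin.succ).updateCol j fun i => M i.succ 0).submatrix
            i.succAbove j.succAbove) := by
        ext a b
        simp [Fin.succ_succAbove_succ]
      rw [h]
      simp [pow_add, pow_succ]
      ring

/-- Border N by a first row of ones and the first column (1, f). Subtracting column 0 from the
others does not change the determinant and turns the border row into (1, 0, …, 0); `det_eq_border`
evaluates both forms. -/
theorem det_sub_const_row {R : Type*} [CommRing R] {r : ℕ} (N : Matrix (Fin r) (Fin r) R)
    (f : Fin r → R) :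
    (of fun i j => N i j - f i).det = N.det - ∑ j, (N.updateCol j f).det := by
  let M : Matrix (Fin (r + 1)) (Fin (r + 1)) R :=
    of fun i j => Fin.cases (Fin.cases 1 (fun _ => 1) j)
      (fun i => Fin.cases (f i) (fun j => N i j) j) i
  let M' : Matrix (Fin (r + 1)) (Fin (r + 1)) R :=
    of fun i j => Fin.cases (Fin.cases 1 (fun _ => 0) j)
      (fun i => Fin.cases (f i) (fun j => N i j - f i) j) i
  have h1 : M.det = N.det - ∑ j, (N.updateCol j f).det := by
    rw [det_eq_border]
    have : M.submatrix Fin.succ Fin.succ = N := by ext; simp [M]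
    rw [this]
    simp [M]
  have h2 : M'.det = (of fun i j => N i j - f i).det := by
    rw [det_eq_border]
    have : M'.submatrix Fin.succ Fin.succ = of fun i j => N i j - f i := by ext; simp [M']
    rw [this]
    simp [M']
  rw [← h1, ← h2]
  rw [← det_transpose M, ← det_transpose M']
  refine det_eq_of_forall_row_eq_smul_add_const (Fin.cases 0 fun _ => -1) 0 (by simp)
    fun j i => ?_
  refine Fin.cases ?_ (fun i => ?_) i <;> refine Fin.cases ?_ (fun j => ?_) j <;> simp [M, M', sub_eq_add_neg]

/-- The hypothesis says diag(a) N + N diag(b) is the all-ones matrix. Multiply by the adjugate and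
take traces: the all-ones side gives the sum of the entries of the adjugate, which is the sum of
Cramer determinants. Applied to the Cauchy matrix 1/(k_i + k'_j). -/
theorem sum_det_updateCol_one {R : Type*} [CommRing R] {r : ℕ} (N : Matrix (Fin r) (Fin r) R)
    (a b : Fin r → R) (h : ∀ i j, (a i + b j) * N i j = 1) :
    ∑ j, (N.updateCol j fun _ => 1).det = (∑ i, (a i + b i)) * N.det := by
  have e : diagonal a * N + N * diagonal b = of fun _ _ => 1 := by
    ext i j
    simp only [add_apply, diagonal_mul, mul_diagonal, of_apply, ← h i j]
    ring
  have e2 := congrArg (fun M => trace (M * adjugate N)) e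
  simp only [add_mul, trace_add, mul_assoc, mul_adjugate] at e2
  rw [trace_mul_comm N, mul_assoc, adjugate_mul] at e2
  have e3 : ∀ c : Fin r → R, trace (diagonal c * N.det • (1 : Matrix (Fin r) (Fin r) R)) =
      (∑ i, c i) * N.det := by
    intro c
    simp [trace, Finset.sum_mul, mul_comm]
  rw [e3, e3] at e2
  rw [Finset.sum_add_distrib, add_mul, e2]
  simp only [← cramer_apply, cramer_eq_adjugate_mulVec, trace, mulVec, dotProduct, diag, mul_apply, of_apply]
  rw [Finset.sum_comm]
  simp

-- Arithmetic-geometric mean for the eigenvalues of M M*: their product is |det M|² and their sum,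
-- the squared Frobenius norm, is at most r².
open scoped ComplexOrder in
theorem norm_det_le_sqrt {r : ℕ} (M : Matrix (Fin r) (Fin r) ℂ) (h : ∀ i j, ‖M i j‖ ≤ 1) :
    ‖M.det‖ ≤ √((r : ℝ) ^ r) := by
  obtain _ | r := r
  · simp
  have hP := posSemidef_self_mul_conjTranspose M
  have hd := hP.1.det_eq_prod_eigenvalues
  have ht := hP.1.trace_eq_sum_eigenvalues
  have hn := hP.eigenvalues_nonneg
  set l := hP.1.eigenvalues
  have h1 : ‖M.det‖ ^ 2 = ∏ i, l i := by
    rw [det_mul, det_conjTranspose] at hd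
    have : (M.det * star M.det : ℂ) = ((‖M.det‖ ^ 2 : ℝ) : ℂ) := by
      simpa using Complex.mul_conj' M.det
    rw [this] at hd
    apply Complex.ofReal_injective
    rw [hd]
    simp
  have h2 : ∑ i, l i ≤ ((r : ℝ) + 1) * (r + 1) := by
    have h3 : (∑ i, l i) = ∑ i, ∑ j, ‖M i j‖ ^ 2 := by
      apply Complex.ofReal_injective
      push_cast
      refine Eq.trans ht.symm ?_
      simp only [trace, diag, mul_apply, conjTranspose_apply]
      refine Finset.sum_congr rfl fun i _ => Finset.sum_congr rfl fun j _ => ?_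
      simpa using Complex.mul_conj' (M i j)
    rw [h3]
    calc _ ≤ ∑ i : Fin (r + 1), ∑ j : Fin (r + 1), (1 : ℝ) := by
          refine Finset.sum_le_sum fun i _ => Finset.sum_le_sum fun j _ => ?_
          exact pow_le_one₀ (norm_nonneg _) (h i j)
      _ = _ := by simp; ring
  have h3 := Real.geom_mean_le_arith_mean Finset.univ (fun _ => 1) l (by simp) (by simp; positivity)
    (fun i _ => hn i)
  simp only [Real.rpow_one, Finset.sum_const, Finset.card_univ, Fintype.card_fin, one_mul,
    nsmul_eq_mul, mul_one] at h3
  have h4 : ∏ i, l i ≤ ((r + 1 : ℕ) : ℝ) ^ (r + 1) := by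
    have h5 : (∏ i, l i) ^ ((((r + 1 : ℕ) : ℝ))⁻¹) ≤ ((r + 1 : ℕ) : ℝ) := by
      refine h3.trans ?_
      rw [div_le_iff₀ (by positivity)]
      push_cast
      exact h2
    have h6 : 0 ≤ ∏ i, l i := Finset.prod_nonneg fun i _ => hn i
    calc ∏ i, l i = ((∏ i, l i) ^ ((((r + 1 : ℕ) : ℝ))⁻¹)) ^ (r + 1) :=
          (Real.rpow_inv_natCast_pow h6 (by simp)).symm
      _ ≤ _ := by gcongr
  exact Real.le_sqrt_of_sq_le (h1 ▸ h4)

theorem norm_det_le {r : ℕ} (M : Matrix (Fin r) (Fin r) ℂ) (F : Fin r → ℝ)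
    (h : ∀ i j, ‖M i j‖ ≤ F i) : ‖M.det‖ ≤ √((r : ℝ) ^ r) * ∏ i, F i := by
  -- A row with F i ≤ 0 is zero. Otherwise each row can be divided by its F i.
  by_cases hF : ∃ i, F i ≤ 0
  · obtain ⟨i, hi⟩ := hF
    have h0 : ∀ j, M i j = 0 := fun j => norm_le_zero_iff.1 ((h i j).trans hi)
    have h1 : 0 ≤ ∏ i, F i := Finset.prod_nonneg fun a _ => (norm_nonneg _).trans (h a i)
    rw [det_eq_zero_of_row_eq_zero i h0, norm_zero]
    positivity
  · push Not at hF
    have hM : M = of fun i j => (F i : ℂ) * (of fun i j => M i j / F i : Matrix _ _ ℂ) i j := by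
      ext i j
      have : (F i : ℂ) ≠ 0 := by exact_mod_cast (hF i).ne'
      simp only [of_apply]
      field_simp
    have hp : ‖(∏ i, (F i : ℂ))‖ = ∏ i, F i := by
      rw [norm_prod]
      exact Finset.prod_congr rfl fun i _ => by simp [abs_of_pos (hF i)]
    rw [hM, det_mul_column, norm_mul, hp, mul_comm]
    refine mul_le_mul_of_nonneg_right (norm_det_le_sqrt _ fun i j => ?_)
      (Finset.prod_nonneg fun i _ => (hF i).le)
    rw [of_apply, norm_div, Complex.norm_real, Real.norm_of_nonneg (hF i).le]
    exact div_le_one_of_le₀ (h i j) (hF i).le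

end Matrix

/-! ### Convergence and differentiation of Fredholm series. -/

theorem Finset.sum_le_prod_one_add {ι : Type*} (s : Finset ι) (f : ι → ℝ) (hf : ∀ i, 0 ≤ f i) :
    ∑ i ∈ s, f i ≤ ∏ i ∈ s, (1 + f i) := by
  classical
  induction s using Finset.induction_on with
  | empty => simp
  | insert i s hi ih =>
    rw [Finset.sum_insert hi, Finset.prod_insert hi]
    have : 1 ≤ ∏ i ∈ s, (1 + f i) :=
      Finset.one_le_prod (f := fun i => 1 + f i) fun i _ => by linarith [hf i]
    nlinarith [hf i]

/-- The general term of the majorant `∑ √(r^r) A^r / r!` of a Fredholm series. -/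
noncomputable def fredholmMajorant (A : ℝ) (r : ℕ) : ℝ :=
  1 / (r.factorial : ℝ) * (√((r : ℝ) ^ r) * A ^ r)

theorem fredholmMajorant_nonneg {A : ℝ} (hA : 0 ≤ A) (r : ℕ) : 0 ≤ fredholmMajorant A r := by
  unfold fredholmMajorant; positivity

theorem fredholmMajorant_mono {A B : ℝ} (hA : 0 ≤ A) (h : A ≤ B) (r : ℕ) :
    fredholmMajorant A r ≤ fredholmMajorant B r := by
  unfold fredholmMajorant; gcongr

/-- Write the term as (1/2)^r · s, which is at most (1/4)^r + s². The square removes the root, and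
r^r/r! ≤ e^r leaves an exponential series. -/
theorem summable_fredholmMajorant {A : ℝ} (hA : 0 ≤ A) : Summable (fredholmMajorant A) := by
  have h1 : Summable fun r : ℕ => ((1 / 4 : ℝ) ^ r + (4 * A ^ 2 * Real.exp 1) ^ r / (r.factorial : ℝ)) :=
    (summable_geometric_of_lt_one (by norm_num) (by norm_num)).add
      (Real.summable_pow_div_factorial _)
  refine Summable.of_nonneg_of_le (fredholmMajorant_nonneg hA) (fun r => ?_) h1
  set s : ℝ := 1 / (r.factorial : ℝ) * (√((r : ℝ) ^ r) * (2 * A) ^ r) with hs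
  have h2 : fredholmMajorant A r = (1 / 2) ^ r * s := by
    have : ((1 / 2 : ℝ) ^ r) * 2 ^ r = 1 := by rw [← mul_pow]; norm_num
    rw [hs, fredholmMajorant, mul_pow]
    linear_combination (-(1 / (r.factorial : ℝ) * √((r : ℝ) ^ r) * A ^ r)) * this
  have h3 : s ^ 2 ≤ (4 * A ^ 2 * Real.exp 1) ^ r / (r.factorial : ℝ) := by
    have h4 := Real.pow_div_factorial_le_exp (r : ℝ) (by positivity) r
    have h5 : Real.exp (r : ℝ) = Real.exp 1 ^ r := by rw [← Real.exp_nat_mul, mul_one]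
    have h6 : s ^ 2 = ((r : ℝ) ^ r / (r.factorial : ℝ)) * ((4 * A ^ 2) ^ r / (r.factorial : ℝ)) := by
      rw [hs, mul_pow, mul_pow, Real.sq_sqrt (by positivity), ← pow_mul, mul_comm r 2, pow_mul]
      field_simp
      ring
    rw [h6, mul_pow (4 * A ^ 2), ← h5, mul_comm _ (Real.exp _), mul_div_assoc]
    gcongr
  have h7 : (1 / 4 : ℝ) ^ r = ((1 / 2) ^ r) ^ 2 := by
    rw [← pow_mul, mul_comm r 2, pow_mul]; norm_num
  rw [h2, h7]
  nlinarith [sq_nonneg ((1 / 2 : ℝ) ^ r - s), sq_nonneg ((1 / 2 : ℝ) ^ r), sq_nonneg s]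

section

variable {X : Type*} [MeasurableSpace X]

/-- The Fredholm series `∑_r (1/r!) ∫ a(z_1) ⋯ a(z_r) Φ_r(z_1, …, z_r)`. -/
noncomputable def fredholmSum (ν : Measure X) (a : X → ℂ) (Φ : ∀ r : ℕ, (Fin r → X) → ℂ) : ℂ :=
  ∑' r : ℕ, (1 / (r.factorial : ℂ)) *
    ∫ z : Fin r → X, (∏ i, a (z i)) * Φ r z ∂(Measure.pi fun _ : Fin r => ν)

/-- The estimate of Hadamard type that makes Fredholm series converge. -/
structure HadamardBound (ν : Measure X) (Φ : ∀ r : ℕ, (Fin r → X) → ℂ) (F : X → ℝ) : Prop where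
  meas : ∀ r, AEStronglyMeasurable (Φ r) (Measure.pi fun _ : Fin r => ν)
  bound : ∀ r, ∀ᵐ z ∂(Measure.pi fun _ : Fin r => ν), ‖Φ r z‖ ≤ √((r : ℝ) ^ r) * ∏ i, F (z i)

variable {ν : Measure X} [SigmaFinite ν] {a : X → ℂ} {Φ : ∀ r : ℕ, (Fin r → X) → ℂ} {F : X → ℝ}

theorem ae_pi_of_ae {P : X → Prop} (h : ∀ᵐ z ∂ν, P z) (r : ℕ) :
    ∀ᵐ z ∂(Measure.pi fun _ : Fin r => ν), ∀ i, P (z i) :=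
  Filter.eventually_all.2 fun i => (Measure.tendsto_eval_ae_ae (i := i)).eventually h

theorem MeasureTheory.AEStronglyMeasurable.finPi_prod (ha : AEStronglyMeasurable a ν) (r : ℕ) :
    AEStronglyMeasurable (fun z : Fin r → X => ∏ i, a (z i)) (Measure.pi fun _ : Fin r => ν) :=
  Finset.aestronglyMeasurable_fun_prod _ fun i _ =>
    ha.comp_quasiMeasurePreserving (Measure.quasiMeasurePreserving_eval _ i)

namespace HadamardBound

omit [SigmaFinite ν] in
theorem ae_norm_le (h : HadamardBound ν Φ F) (a : X → ℂ) (r : ℕ) :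
    ∀ᵐ z ∂(Measure.pi fun _ : Fin r => ν),
      ‖(∏ i, a (z i)) * Φ r z‖ ≤ √((r : ℝ) ^ r) * ∏ i, ‖a (z i)‖ * F (z i) := by
  filter_upwards [h.bound r] with z hz
  rw [norm_mul, norm_prod, Finset.prod_mul_distrib, mul_left_comm]
  gcongr

theorem integrable (h : HadamardBound ν Φ F) (ha : AEStronglyMeasurable a ν)
    (hF : Integrable (fun z => ‖a z‖ * F z) ν) (r : ℕ) :
    Integrable (fun z : Fin r → X => (∏ i, a (z i)) * Φ r z) (Measure.pi fun _ : Fin r => ν) :=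
  ((Integrable.fintype_prod fun _ => hF).const_mul _).mono' ((ha.finPi_prod r).mul (h.meas r))
    (h.ae_norm_le a r)

theorem norm_term_le (h : HadamardBound ν Φ F) (hF : Integrable (fun z => ‖a z‖ * F z) ν) (r : ℕ) :
    ‖(1 / (r.factorial : ℂ)) *
      ∫ z : Fin r → X, (∏ i, a (z i)) * Φ r z ∂(Measure.pi fun _ : Fin r => ν)‖ ≤
    fredholmMajorant (∫ z, ‖a z‖ * F z ∂ν) r := by
  rw [norm_mul, fredholmMajorant]
  have h1 : ‖(1 / (r.factorial : ℂ))‖ = 1 / (r.factorial : ℝ) := by simp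
  rw [h1]
  refine mul_le_mul_of_nonneg_left ?_ (by positivity)
  refine (norm_integral_le_of_norm_le ((Integrable.fintype_prod fun _ => hF).const_mul _)
    (h.ae_norm_le a r)).trans (le_of_eq ?_)
  rw [integral_const_mul, integral_fintype_prod_eq_pow (fun z => ‖a z‖ * F z)]
  simp

theorem summable (h : HadamardBound ν Φ F) (hF0 : ∀ z, 0 ≤ F z)
    (hF : Integrable (fun z => ‖a z‖ * F z) ν) :
    Summable fun r : ℕ => (1 / (r.factorial : ℂ)) *
      ∫ z : Fin r → X, (∏ i, a (z i)) * Φ r z ∂(Measure.pi fun _ : Fin r => ν) :=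
  .of_norm_bounded (summable_fredholmMajorant
    (integral_nonneg fun z => mul_nonneg (norm_nonneg _) (hF0 z))) (h.norm_term_le hF)

theorem norm_fredholmSum_le (h : HadamardBound ν Φ F) (hF0 : ∀ z, 0 ≤ F z)
    (hF : Integrable (fun z => ‖a z‖ * F z) ν) {A : ℝ} (hA : ∫ z, ‖a z‖ * F z ∂ν ≤ A) :
    ‖fredholmSum ν a Φ‖ ≤ ∑' r, fredholmMajorant A r := by
  have h0 : 0 ≤ ∫ z, ‖a z‖ * F z ∂ν := integral_nonneg fun z => mul_nonneg (norm_nonneg _) (hF0 z)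
  exact tsum_of_norm_bounded (summable_fredholmMajorant (h0.trans hA)).hasSum
    fun r => (h.norm_term_le hF r).trans (fredholmMajorant_mono h0 hA r)

-- Differentiating a product of exponential weights brings down the factor ∑ E(z_i). Since ∑
-- |E(z_i)| ≤ ∏ (1 + |E(z_i)|), it is absorbed into the one-variable majorant, so the class of
-- series is stable under differentiation.
omit [SigmaFinite ν] in
theorem mul_sum (h : HadamardBound ν Φ F) (hF0 : ∀ z, 0 ≤ F z) {E : X → ℂ} (hE : Measurable E) :
    HadamardBound ν (fun r z => (∑ i, E (z i)) * Φ r z) (fun z => F z * (1 + ‖E z‖)) where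
  meas r := by
    refine AEStronglyMeasurable.mul ?_ (h.meas r)
    exact (Finset.measurable_fun_sum _ fun i _ => hE.comp (measurable_pi_apply i)).aestronglyMeasurable
  bound r := by
    filter_upwards [h.bound r] with z hz
    rw [norm_mul, Finset.prod_mul_distrib, ← mul_assoc, mul_comm]
    have h1 : ‖∑ i, E (z i)‖ ≤ ∏ i, (1 + ‖E (z i)‖) := by
      exact (norm_sum_le _ _).trans (Finset.sum_le_prod_one_add _ _ fun i => norm_nonneg _)
    have h2 : 0 ≤ ∏ i, F (z i) := Finset.prod_nonneg fun i _ => hF0 _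
    gcongr

/-- As ∂a = E a, the logarithmic derivative of ∏ a(z_i) is ∑ E(z_i). The dominating function α
serves twice: for differentiation under each r-fold integral and for a summable bound on the
differentiated terms that is uniform in x. -/
theorem hasDerivAt (h : HadamardBound ν Φ F) (hF0 : ∀ z, 0 ≤ F z) {E : X → ℂ} (hE : Measurable E)
    {a : ℝ → X → ℂ} {α : X → ℝ} {I : Set ℝ} (hIo : IsOpen I) (hIc : IsPreconnected I)
    (ham : ∀ x ∈ I, AEStronglyMeasurable (a x) ν)
    (had : ∀ x ∈ I, ∀ z, HasDerivAt (fun x => a x z) (E z * a x z) x)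
    (haα : ∀ x ∈ I, ∀ z, ‖a x z‖ ≤ α z)
    (hα : AEStronglyMeasurable α ν)
    (hαF : Integrable (fun z => α z * (F z * (1 + ‖E z‖))) ν) (hF : AEStronglyMeasurable F ν)
    {x : ℝ} (hx : x ∈ I) :
    HasDerivAt (fun x => fredholmSum ν (a x) Φ)
      (fredholmSum ν (a x) fun r z => (∑ i, E (z i)) * Φ r z) x := by
  have hE0 : ∀ z, 0 ≤ ‖E z‖ := fun z => norm_nonneg _
  have hα0 : ∀ z, 0 ≤ α z := fun z => (norm_nonneg _).trans (haα x hx z)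
  have h' := h.mul_sum hF0 hE
  have hF0' : ∀ z, 0 ≤ F z * (1 + ‖E z‖) := fun z => mul_nonneg (hF0 z) (by positivity)
  have hEm : AEStronglyMeasurable (fun z => ‖E z‖) ν := hE.norm.aestronglyMeasurable
  have hαF1 : Integrable (fun z => α z * F z) ν := by
    refine hαF.mono' (hα.mul hF) (.of_forall fun z => ?_)
    rw [Real.norm_of_nonneg (mul_nonneg (hα0 z) (hF0 z))]
    have := mul_nonneg (mul_nonneg (hα0 z) (hF0 z)) (hE0 z)
    nlinarith
  have key1 : ∀ y ∈ I, Integrable (fun z => ‖a y z‖ * F z) ν := fun y hy => by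
    refine hαF1.mono' ((ham y hy).norm.mul hF) (.of_forall fun z => ?_)
    rw [Real.norm_of_nonneg (mul_nonneg (norm_nonneg _) (hF0 z))]
    exact mul_le_mul_of_nonneg_right (haα y hy z) (hF0 z)
  have key2 : ∀ y ∈ I, Integrable (fun z => ‖a y z‖ * (F z * (1 + ‖E z‖))) ν := fun y hy => by
    refine hαF.mono' ((ham y hy).norm.mul (hF.mul (hEm.const_add 1))) (.of_forall fun z => ?_)
    rw [Real.norm_of_nonneg (mul_nonneg (norm_nonneg _) (hF0' z))]
    exact mul_le_mul_of_nonneg_right (haα y hy z) (hF0' z)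
  unfold fredholmSum
  refine hasDerivAt_tsum_of_isPreconnected
    (g := fun r y => (1 / (r.factorial : ℂ)) *
      ∫ z : Fin r → X, (∏ i, a y (z i)) * Φ r z ∂(Measure.pi fun _ : Fin r => ν))
    (g' := fun r y => (1 / (r.factorial : ℂ)) *
      ∫ z : Fin r → X, (∏ i, a y (z i)) * ((∑ i, E (z i)) * Φ r z)
        ∂(Measure.pi fun _ : Fin r => ν))
    (u := fredholmMajorant (∫ z, α z * (F z * (1 + ‖E z‖)) ∂ν))
    (summable_fredholmMajorant (integral_nonneg fun z => mul_nonneg (hα0 z) (hF0' z))) hIo hIc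
    (fun r y hy => ?_) (fun r y hy => ?_) hx (h.summable hF0 (key1 x hx)) hx
  · refine HasDerivAt.const_mul _ ?_
    refine (hasDerivAt_integral_of_dominated_loc_of_deriv_le (s := I)
      (bound := fun z : Fin r → X => √((r : ℝ) ^ r) * ∏ i, α (z i) * (F (z i) * (1 + ‖E (z i)‖)))
      (F' := fun y z => (∏ i, a y (z i)) * ((∑ i, E (z i)) * Φ r z))
      (hIo.mem_nhds hy) ?_ (h.integrable (ham y hy) (key1 y hy) r) ?_ ?_ ?_ ?_).2
    · filter_upwards [hIo.mem_nhds hy] with y hy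
      exact (h.integrable (ham y hy) (key1 y hy) r).1
    · exact (h'.integrable (ham y hy) (key2 y hy) r).1
    · filter_upwards [h'.bound r] with z hz y hy
      rw [norm_mul, norm_prod, Finset.prod_mul_distrib, mul_left_comm]
      refine mul_le_mul (Finset.prod_le_prod (fun _ _ => norm_nonneg _) fun i _ => haα y hy _) hz
        (norm_nonneg _) (Finset.prod_nonneg fun i _ => hα0 _)
    · exact (Integrable.fintype_prod fun _ => hαF).const_mul _
    · refine .of_forall fun z y hy => ?_
      have h1 : HasDerivAt (fun y => ∏ i, a y (z i)) ((∏ i, a y (z i)) * ∑ i, E (z i)) y := by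
        refine (HasDerivAt.fun_finsetProd (u := Finset.univ)
          fun i _ => had y hy (z i)).congr_deriv ?_
        rw [Finset.mul_sum]
        refine Finset.sum_congr rfl fun i _ => ?_
        rw [← Finset.mul_prod_erase _ _ (Finset.mem_univ i), smul_eq_mul]
        ring
      simpa [mul_assoc] using h1.mul_const (Φ r z)
  · refine (h'.norm_term_le (key2 y hy) r).trans ?_
    refine fredholmMajorant_mono (integral_nonneg fun z => mul_nonneg (norm_nonneg _) (hF0' z)) ?_ r
    exact integral_mono (key2 y hy) hαF fun z => mul_le_mul_of_nonneg_right (haα y hy z) (hF0' z)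

end HadamardBound

end

/-! ### Cramer's rule for Fredholm equations. -/

section

variable {X : Type*} [MeasurableSpace X]

/-- The determinants `det [K(z_i, z_j)]`. -/
noncomputable def kernelDet (K : X → X → ℂ) (r : ℕ) (z : Fin r → X) : ℂ :=
  (Matrix.of fun i j => K (z i) (z j)).det

/-- The determinant of `[K(z_i, z_j)]` with the `j`-th column replaced by `f(z_i)`. -/
noncomputable def kernelColDet (K : X → X → ℂ) (f : X → ℂ) (r : ℕ) (j : Fin r) (z : Fin r → X) : ℂ :=
  ((Matrix.of fun i j => K (z i) (z j)).updateCol j fun i => f (z i)).det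

/-- The sum of the determinants of `[K(z_i, z_j)]` with one column replaced by `f(z_i)`. -/
noncomputable def kernelCramer (K : X → X → ℂ) (f : X → ℂ) (r : ℕ) (z : Fin r → X) : ℂ :=
  ∑ j, kernelColDet K f r j z

-- Links order r+1 to order r. Once integrated against φ(y), the coefficients become ∫ φ f and ∫ φ
-- K(·, z_j), and the latter is supplied by the integral equation.
omit [MeasurableSpace X] in
theorem kernelColDet_cons (K : X → X → ℂ) (f : X → ℂ) (r : ℕ) (y : X) (z : Fin r → X) :
    kernelColDet K f (r + 1) 0 (Fin.cons y z) =
      f y * kernelDet K r z - ∑ j, K y (z j) * kernelColDet K f r j z := by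
  rw [kernelColDet, Matrix.det_eq_border]
  have : ((Matrix.of fun i j => K (Fin.cons (α := fun _ => X) y z i) (Fin.cons (α := fun _ => X) y z j)).updateCol 0
      fun i => f (Fin.cons (α := fun _ => X) y z i)).submatrix Fin.succ Fin.succ = Matrix.of fun i j => K (z i) (z j) := by
    ext; simp
  rw [this]
  simp [kernelDet, kernelColDet]

omit [MeasurableSpace X] in
theorem kernelColDet_perm (K : X → X → ℂ) (f : X → ℂ) (r : ℕ) (j : Fin r) (e : Equiv.Perm (Fin r))
    (z : Fin r → X) : kernelColDet K f r j (fun i => z (e i)) = kernelColDet K f r (e j) z := by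
  rw [kernelColDet, kernelColDet]
  conv_rhs => rw [← Matrix.det_submatrix_equiv_self e]
  congr 1
  ext a b
  simp [Matrix.updateCol_apply]

theorem measurable_kernelDet {K : X → X → ℂ} (hK : Measurable fun q : X × X => K q.1 q.2) (r : ℕ) :
    Measurable (kernelDet K r) := by
  unfold kernelDet
  simp only [Matrix.det_apply']
  refine Finset.measurable_fun_sum _ fun σ _ => Measurable.const_mul ?_ _
  exact Finset.measurable_fun_prod _ fun i _ =>
    hK.comp (f := fun z : Fin r → X => (z (σ i), z i)) (by fun_prop)

theorem measurable_kernelColDet {K : X → X → ℂ} (hK : Measurable fun q : X × X => K q.1 q.2)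
    {f : X → ℂ} (hf : Measurable f) (r : ℕ) (j : Fin r) :
    Measurable (kernelColDet K f r j) := by
  unfold kernelColDet
  simp only [Matrix.det_apply']
  refine Finset.measurable_fun_sum _ fun σ _ => Measurable.const_mul ?_ _
  refine Finset.measurable_fun_prod _ fun i _ => ?_
  simp only [Matrix.updateCol_apply]
  split_ifs
  · exact hf.comp (measurable_pi_apply (σ i))
  · exact hK.comp (f := fun z : Fin r → X => (z (σ i), z i)) (by fun_prop)

omit [MeasurableSpace X] in
theorem norm_kernelColDet_le {D : Set X} {K : X → X → ℂ} {f : X → ℂ} {F : X → ℝ}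
    (hK : ∀ y ∈ D, ∀ z ∈ D, ‖K y z‖ ≤ F y) (hf : ∀ y ∈ D, ‖f y‖ ≤ F y)
    {r : ℕ} (j : Fin r) {z : Fin r → X} (hz : ∀ i, z i ∈ D) :
    ‖kernelColDet K f r j z‖ ≤ √((r : ℝ) ^ r) * ∏ i, F (z i) := by
  refine Matrix.norm_det_le _ _ fun a b => ?_
  rw [Matrix.updateCol_apply]
  split_ifs
  · exact hf _ (hz a)
  · exact hK _ (hz a) _ (hz b)

variable {ν : Measure X} {D : Set X} {K : X → X → ℂ} {f : X → ℂ} {F : X → ℝ}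

theorem hadamardBound_kernelDet [SigmaFinite ν] (hD : ∀ᵐ z ∂ν, z ∈ D)
    (hKm : Measurable fun q : X × X => K q.1 q.2)
    (hK : ∀ y ∈ D, ∀ z ∈ D, ‖K y z‖ ≤ F y) :
    HadamardBound ν (kernelDet K) F where
  meas r := (measurable_kernelDet hKm r).aestronglyMeasurable
  bound r := by
    filter_upwards [ae_pi_of_ae hD r] with z hz
    exact Matrix.norm_det_le _ _ fun i j => hK _ (hz i) _ (hz j)

/-- The factor 2 in the majorant pays for the r columns, through r ≤ 2^r. -/
theorem hadamardBound_kernelCramer [SigmaFinite ν] (hD : ∀ᵐ z ∂ν, z ∈ D)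
    (hKm : Measurable fun q : X × X => K q.1 q.2)
    (hK : ∀ y ∈ D, ∀ z ∈ D, ‖K y z‖ ≤ F y) (hfm : Measurable f)
    (hf : ∀ y ∈ D, ‖f y‖ ≤ F y) :
    HadamardBound ν (kernelCramer K f) (fun z => 2 * F z) where
  meas r := (Finset.measurable_fun_sum _ fun j _ =>
    measurable_kernelColDet hKm hfm r j).aestronglyMeasurable
  bound r := by
    filter_upwards [ae_pi_of_ae hD r] with z hz
    refine (norm_sum_le_of_le _ fun j _ => norm_kernelColDet_le hK hf j hz).trans ?_
    rw [Finset.prod_mul_distrib]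
    simp only [Finset.sum_const, Finset.card_univ, Fintype.card_fin, nsmul_eq_mul,
      Finset.prod_const]
    have h1 : (r : ℝ) ≤ 2 ^ r := by exact_mod_cast Nat.lt_two_pow_self.le
    have h2 : 0 ≤ ∏ i, F (z i) :=
      Finset.prod_nonneg fun i _ => (norm_nonneg _).trans (hf _ (hz i))
    rw [mul_left_comm]
    gcongr

/-- The integral of the determinant with column `j` replaced by `f`, in which the weight of the
`j`-th variable is `φ` and that of the others is `a`. -/
noncomputable def cramerIntegral (ν : Measure X) (a φ : X → ℂ) (K : X → X → ℂ) (f : X → ℂ) (r : ℕ)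
    (j : Fin r) : ℂ :=
  ∫ z : Fin r → X, (∏ i, Function.update (fun _ => a) j φ i (z i)) * kernelColDet K f r j z
    ∂(Measure.pi fun _ : Fin r => ν)

variable [SigmaFinite ν] {a φ : X → ℂ}

/-- Swapping the variables j and 0 permutes rows and columns simultaneously, so no sign appears. -/
theorem cramerIntegral_eq_zero_index (r : ℕ) (j : Fin (r + 1)) :
    cramerIntegral ν a φ K f (r + 1) j = cramerIntegral ν a φ K f (r + 1) 0 := by
  let e := Equiv.swap j 0
  rw [cramerIntegral, cramerIntegral,
    ← (measurePreserving_piCongrLeft (fun _ : Fin (r + 1) => ν) e).integral_comp']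
  congr 1
  ext z
  have h : MeasurableEquiv.piCongrLeft (fun _ : Fin (r + 1) => X) e z = fun i => z (e i) := by
    ext i
    have := MeasurableEquiv.piCongrLeft_apply_apply (β := fun _ : Fin (r + 1) => X) e z (e i)
    simpa [e] using this
  rw [h, kernelColDet_perm]
  congr 1
  · refine (Finset.prod_congr rfl fun i _ => ?_).trans (Equiv.prod_comp e _)
    have : Function.update (fun _ => a) j φ i = Function.update (fun _ => a) 0 φ (e i) := by
      simp only [Function.update_apply]
      have : i = j ↔ e i = 0 := by simp [e, Equiv.swap_apply_eq_iff]
      simp [this]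
    simp [this, e]
  · simp [e]

theorem ae_norm_cramer_le (hD : ∀ᵐ z ∂ν, z ∈ D)
    (hK : ∀ y ∈ D, ∀ z ∈ D, ‖K y z‖ ≤ F y) (hf : ∀ y ∈ D, ‖f y‖ ≤ F y) {r : ℕ}
    (b : Fin r → X → ℂ) (j : Fin r) :
    ∀ᵐ z ∂(Measure.pi fun _ : Fin r => ν), ‖(∏ i, b i (z i)) * kernelColDet K f r j z‖ ≤
      √((r : ℝ) ^ r) * ∏ i, ‖b i (z i)‖ * F (z i) := by
  filter_upwards [ae_pi_of_ae hD r] with z hz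
  rw [norm_mul, norm_prod, Finset.prod_mul_distrib, mul_left_comm]
  gcongr
  exact norm_kernelColDet_le hK hf j hz

omit [SigmaFinite ν] in
theorem integrable_update_mul (ha : Integrable (fun z => ‖a z‖ * F z) ν)
    (hφ : Integrable (fun z => ‖φ z‖ * F z) ν) {r : ℕ} (j i : Fin r) :
    Integrable (fun z => ‖Function.update (fun _ => a) j φ i z‖ * F z) ν := by
  rw [Function.update_apply]
  split_ifs <;> assumption

theorem integrable_cramer (hD : ∀ᵐ z ∂ν, z ∈ D)
    (hKm : Measurable fun q : X × X => K q.1 q.2)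
    (hK : ∀ y ∈ D, ∀ z ∈ D, ‖K y z‖ ≤ F y) (hfm : Measurable f) (hf : ∀ y ∈ D, ‖f y‖ ≤ F y)
    (ham : AEStronglyMeasurable a ν) (ha : Integrable (fun z => ‖a z‖ * F z) ν)
    (hφm : AEStronglyMeasurable φ ν) (hφ : Integrable (fun z => ‖φ z‖ * F z) ν)
    {r : ℕ} (j : Fin r) :
    Integrable (fun z : Fin r → X =>
      (∏ i, Function.update (fun _ => a) j φ i (z i)) * kernelColDet K f r j z)
      (Measure.pi fun _ : Fin r => ν) := by
  refine ((Integrable.fintype_prod (integrable_update_mul ha hφ j)).const_mul _).mono'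
    (AEStronglyMeasurable.mul ?_ (measurable_kernelColDet hKm hfm r j).aestronglyMeasurable)
    (ae_norm_cramer_le hD hK hf _ j)
  refine Finset.aestronglyMeasurable_fun_prod _ fun i _ => ?_
  refine AEStronglyMeasurable.comp_quasiMeasurePreserving (g := Function.update (fun _ => a) j φ i)
    ?_ (Measure.quasiMeasurePreserving_eval (fun _ : Fin r => ν) i)
  rw [Function.update_apply]
  split_ifs <;> assumption

theorem norm_cramerIntegral_le (hD : ∀ᵐ z ∂ν, z ∈ D)
    (hK : ∀ y ∈ D, ∀ z ∈ D, ‖K y z‖ ≤ F y) (hf : ∀ y ∈ D, ‖f y‖ ≤ F y) (hF0 : ∀ z, 0 ≤ F z)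
    (ha : Integrable (fun z => ‖a z‖ * F z) ν) (hφ : Integrable (fun z => ‖φ z‖ * F z) ν)
    {A : ℝ} (haA : ∫ z, ‖a z‖ * F z ∂ν ≤ A) (hφA : ∫ z, ‖φ z‖ * F z ∂ν ≤ A) {r : ℕ} (j : Fin r) :
    ‖cramerIntegral ν a φ K f r j‖ ≤ √((r : ℝ) ^ r) * A ^ r := by
  have hI := integrable_update_mul ha hφ j
  refine (norm_integral_le_of_norm_le ((Integrable.fintype_prod hI).const_mul _)
    (ae_norm_cramer_le hD hK hf _ j)).trans ?_
  rw [integral_const_mul]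
  refine mul_le_mul_of_nonneg_left ?_ (by positivity)
  rw [integral_fintype_prod_eq_prod (fun i z => ‖Function.update (fun _ => a) j φ i z‖ * F z)]
  refine (Finset.prod_le_prod (fun i _ => integral_nonneg fun z =>
    mul_nonneg (norm_nonneg _) (hF0 z)) (g := fun _ => A) fun i _ => ?_).trans (by simp)
  simp only [Function.update_apply]
  split_ifs <;> assumption

/-- Fubini: the variable 0, which carries the weight φ, is integrated first. -/
theorem cramerIntegral_succ (hD : ∀ᵐ z ∂ν, z ∈ D)
    (hKm : Measurable fun q : X × X => K q.1 q.2)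
    (hK : ∀ y ∈ D, ∀ z ∈ D, ‖K y z‖ ≤ F y) (hfm : Measurable f) (hf : ∀ y ∈ D, ‖f y‖ ≤ F y)
    (ham : AEStronglyMeasurable a ν) (ha : Integrable (fun z => ‖a z‖ * F z) ν)
    (hφm : AEStronglyMeasurable φ ν) (hφ : Integrable (fun z => ‖φ z‖ * F z) ν) (r : ℕ) :
    Integrable (fun z : Fin r → X => (∏ i, a (z i)) *
        ∫ y, φ y * kernelColDet K f (r + 1) 0 (Fin.cons y z) ∂ν) (Measure.pi fun _ : Fin r => ν) ∧
    cramerIntegral ν a φ K f (r + 1) 0 =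
      ∫ z : Fin r → X, (∏ i, a (z i)) *
        ∫ y, φ y * kernelColDet K f (r + 1) 0 (Fin.cons y z) ∂ν ∂(Measure.pi fun _ : Fin r => ν) := by
  have hmp := (measurePreserving_piFinSuccAbove (fun _ : Fin (r + 1) => ν) 0).symm
  have hI := integrable_cramer hD hKm hK hfm hf ham ha hφm hφ (0 : Fin (r + 1))
  have hI2 := (hmp.integrable_comp_emb (MeasurableEquiv.measurableEmbedding _)).2 hI
  have hfun : ∀ q : X × (Fin r → X),
      (∏ i, Function.update (fun _ => a) 0 φ i
        ((MeasurableEquiv.piFinSuccAbove (fun _ : Fin (r + 1) => X) 0).symm q i)) *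
      kernelColDet K f (r + 1) 0 ((MeasurableEquiv.piFinSuccAbove (fun _ : Fin (r + 1) => X) 0).symm q) =
      (∏ i, a (q.2 i)) * (φ q.1 * kernelColDet K f (r + 1) 0 (Fin.cons q.1 q.2)) := by
    intro q
    have : (MeasurableEquiv.piFinSuccAbove (fun _ : Fin (r + 1) => X) 0).symm q =
      Fin.cons q.1 q.2 := by
      ext i
      simp [MeasurableEquiv.piFinSuccAbove, Fin.insertNthEquiv]
    rw [this, Fin.prod_univ_succ]
    simp
    ring
  have hI3 : Integrable (fun q : X × (Fin r → X) =>
      (∏ i, a (q.2 i)) * (φ q.1 * kernelColDet K f (r + 1) 0 (Fin.cons q.1 q.2)))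
      (ν.prod (Measure.pi fun _ : Fin r => ν)) := by
    refine hI2.congr (.of_forall fun q => hfun q)
  constructor
  · simpa only [integral_const_mul] using hI3.integral_prod_right
  · rw [cramerIntegral, ← hmp.integral_comp']
    simp only [hfun]
    refine (integral_prod_symm _ hI3).trans ?_
    simp only [integral_const_mul]

/-- In column j use c a(z_j) = φ(z_j) + a(z_j) ∫ φ K(·, z_j). The first part gives the order-r
Cramer integrals. The second, summed over j, is by the bordered expansion ∫ φ f times the
determinant minus the Cramer integral of order r+1. -/
theorem cramerIntegral_relation (hD : ∀ᵐ z ∂ν, z ∈ D)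
    (hKm : Measurable fun q : X × X => K q.1 q.2)
    (hK : ∀ y ∈ D, ∀ z ∈ D, ‖K y z‖ ≤ F y) (hfm : Measurable f) (hf : ∀ y ∈ D, ‖f y‖ ≤ F y)
    (ham : AEStronglyMeasurable a ν) (ha : Integrable (fun z => ‖a z‖ * F z) ν)
    (hφm : AEStronglyMeasurable φ ν) (hφ : Integrable (fun z => ‖φ z‖ * F z) ν) {c : ℂ}
    (heq : ∀ᵐ z' ∂ν, c * a z' = φ z' + a z' * ∫ y, φ y * K y z' ∂ν) (r : ℕ) :
    c * ∫ z : Fin r → X, (∏ i, a (z i)) * kernelCramer K f r z ∂(Measure.pi fun _ : Fin r => ν) =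
      (∑ j, cramerIntegral ν a φ K f r j) +
      (∫ y, φ y * f y ∂ν) * ∫ z : Fin r → X, (∏ i, a (z i)) * kernelDet K r z
        ∂(Measure.pi fun _ : Fin r => ν) - cramerIntegral ν a φ K f (r + 1) 0 := by
  have hφf : Integrable (fun y => φ y * f y) ν := by
    refine hφ.mono' (hφm.mul hfm.aestronglyMeasurable) ?_
    filter_upwards [hD] with y hy
    rw [norm_mul]
    exact mul_le_mul_of_nonneg_left (hf y hy) (norm_nonneg _)
  have hφK : ∀ z ∈ D, Integrable (fun y => φ y * K y z) ν := fun z hz => by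
    refine hφ.mono' (hφm.mul (hKm.comp (f := fun y => (y, z)) (by fun_prop)).aestronglyMeasurable) ?_
    filter_upwards [hD] with y hy
    rw [norm_mul]
    exact mul_le_mul_of_nonneg_left (hK y hy z hz) (norm_nonneg _)
  obtain ⟨hI, hS⟩ := cramerIntegral_succ hD hKm hK hfm hf ham ha hφm hφ r
  have hdet := (hadamardBound_kernelDet hD hKm hK).integrable ham ha r
  rw [hS, ← integral_const_mul, ← integral_const_mul]
  unfold cramerIntegral
  rw [← integral_finsetSum _ fun j _ => integrable_cramer hD hKm hK hfm hf ham ha hφm hφ j,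
    ← integral_add (integrable_finsetSum _ fun j _ =>
      integrable_cramer hD hKm hK hfm hf ham ha hφm hφ j) (hdet.const_mul _)]
  refine Eq.trans (integral_congr_ae ?_) (integral_sub ((integrable_finsetSum _ fun j _ =>
      integrable_cramer hD hKm hK hfm hf ham ha hφm hφ j).add (hdet.const_mul _)) hI)
  filter_upwards [ae_pi_of_ae hD r, ae_pi_of_ae heq r] with z hz hez
  have h1 : ∀ j, c * ((∏ i, a (z i)) * kernelColDet K f r j z) =
      (∏ i, Function.update (fun _ => a) j φ i (z i)) * kernelColDet K f r j z +
      (∏ i, a (z i)) * ((∫ y, φ y * K y (z j) ∂ν) * kernelColDet K f r j z) := fun j => by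
    have h2 : ∏ i, Function.update (fun _ => a) j φ i (z i) =
        φ (z j) * ∏ i ∈ Finset.univ.erase j, a (z i) := by
      rw [← Finset.mul_prod_erase _ _ (Finset.mem_univ j), Function.update_self]
      congr 1
      exact Finset.prod_congr rfl fun i hi => by
        rw [Function.update_of_ne (Finset.ne_of_mem_erase hi)]
    rw [h2, ← Finset.mul_prod_erase _ _ (Finset.mem_univ j)]
    linear_combination ((∏ i ∈ Finset.univ.erase j, a (z i)) * kernelColDet K f r j z) * hez j
  have h3 : ∫ y, φ y * kernelColDet K f (r + 1) 0 (Fin.cons y z) ∂ν =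
      (∫ y, φ y * f y ∂ν) * kernelDet K r z -
        ∑ j, (∫ y, φ y * K y (z j) ∂ν) * kernelColDet K f r j z := by
    simp only [← integral_mul_const]
    rw [← integral_finsetSum _ fun j _ => (hφK _ (hz j)).mul_const _,
      ← integral_sub (hφf.mul_const _) (integrable_finsetSum _ fun j _ =>
        (hφK _ (hz j)).mul_const _)]
    congr 1
    ext y
    rw [kernelColDet_cons, mul_sub, Finset.mul_sum]
    simp only [mul_assoc]
  simp only [kernelCramer]
  rw [h3, Finset.mul_sum, Finset.mul_sum, Finset.sum_congr rfl fun j _ => h1 j,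
    Finset.sum_add_distrib, ← Finset.mul_sum]
  ring

/-- Cramer's rule for a Fredholm equation with constant right-hand side. -/
theorem fredholm_cramer (hD : ∀ᵐ z ∂ν, z ∈ D)
    (hKm : Measurable fun q : X × X => K q.1 q.2)
    (hK : ∀ y ∈ D, ∀ z ∈ D, ‖K y z‖ ≤ F y) (hfm : Measurable f) (hf : ∀ y ∈ D, ‖f y‖ ≤ F y)
    (hF0 : ∀ z, 0 ≤ F z)
    (ham : AEStronglyMeasurable a ν) (ha : Integrable (fun z => ‖a z‖ * F z) ν)
    (hφm : AEStronglyMeasurable φ ν) (hφ : Integrable (fun z => ‖φ z‖ * F z) ν) {c : ℂ}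
    (heq : ∀ᵐ z' ∂ν, c * a z' = φ z' + a z' * ∫ y, φ y * K y z' ∂ν) :
    fredholmSum ν a (kernelDet K) * ∫ y, φ y * f y ∂ν =
      c * fredholmSum ν a (kernelCramer K f) := by
  -- One constant dominating both weights, since the Cramer integrals mix a and φ.
  set A : ℝ := ∫ z, ‖a z‖ * F z ∂ν + ∫ z, ‖φ z‖ * F z ∂ν with hA
  have ha0 : 0 ≤ ∫ z, ‖a z‖ * F z ∂ν := integral_nonneg fun z => mul_nonneg (norm_nonneg _) (hF0 z)
  have hφ0 : 0 ≤ ∫ z, ‖φ z‖ * F z ∂ν := integral_nonneg fun z => mul_nonneg (norm_nonneg _) (hF0 z)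
  have hdet := (hadamardBound_kernelDet hD hKm hK).summable hF0 ha
  set p : ℕ → ℂ := fun r => (1 / (r.factorial : ℂ)) * cramerIntegral ν a φ K f (r + 1) 0 with hp
  have hps : Summable p := by
    refine .of_norm_bounded ((summable_nat_add_iff 1).2
      (summable_fredholmMajorant (A := 2 * A) (by positivity))) fun r => ?_
    have h1 := norm_cramerIntegral_le hD hK hf hF0 ha hφ (A := A) (by linarith) (by linarith)
      (0 : Fin (r + 1))
    have h2 : ((r + 1 : ℕ) : ℝ) ≤ 2 ^ (r + 1) := by exact_mod_cast Nat.lt_two_pow_self.le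
    -- Here p r has order r+1 but is divided only by r!. The missing factor r+1 is at most 2^(r+1),
    -- whence the majorant with 2A.
    have h3 : ‖(1 / (r.factorial : ℂ))‖ = ((r + 1 : ℕ) : ℝ) * (1 / ((r + 1).factorial : ℝ)) := by
      rw [Nat.factorial_succ]
      push_cast
      have : ((r : ℝ) + 1) ≠ 0 := by positivity
      simp
      field_simp
    rw [hp, norm_mul, h3, fredholmMajorant, mul_pow]
    calc _ ≤ 2 ^ (r + 1) * (1 / ((r + 1).factorial : ℝ)) *
          (√(((r + 1 : ℕ) : ℝ) ^ (r + 1)) * A ^ (r + 1)) := by gcongr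
      _ = _ := by ring
  -- The r equal Cramer integrals of order r, divided by r!, give p (r-1); for r = 0 the sum is
  -- empty.
  have hq : ∀ r : ℕ, (1 / (r.factorial : ℂ)) * ∑ j, cramerIntegral ν a φ K f r j =
      Nat.rec 0 (fun s _ => p s) r := by
    rintro (_ | r)
    · simp
    · simp only [cramerIntegral_eq_zero_index, Finset.sum_const, Finset.card_univ,
        Fintype.card_fin, nsmul_eq_mul, hp, Nat.factorial_succ]
      push_cast
      have : (r : ℂ) + 1 ≠ 0 := by exact_mod_cast r.succ_ne_zero
      have : (r.factorial : ℂ) ≠ 0 := by exact_mod_cast r.factorial_ne_zero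
      field_simp
  have hqs : HasSum (fun r => (Nat.rec 0 (fun s _ => p s) r : ℂ)) (∑' r, p r) := by
    rw [← hasSum_nat_add_iff' 1]
    simpa using hps.hasSum
  -- The shifted series of p and the series of p have the same sum, so the Cramer integrals cancel.
  have hsum := (hqs.add (hdet.hasSum.mul_left (∫ y, φ y * f y ∂ν))).sub hps.hasSum
  rw [add_sub_cancel_left] at hsum
  rw [mul_comm, fredholmSum, ← hsum.tsum_eq, fredholmSum, ← tsum_mul_left]
  congr 1
  ext r
  rw [← hq r, hp, mul_left_comm c,
    cramerIntegral_relation hD hKm hK hfm hf ham ha hφm hφ heq r]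
  ring

end

section

variable {X : Type*} [MeasurableSpace X] {ν : Measure X} [SigmaFinite ν] {D : Set X}
  {K : X → X → ℂ} {f : X → ℂ} {F : X → ℝ} {a φ : X → ℂ}

theorem fredholmSum_congr {b : X → ℂ} {Φ Ψ : ∀ r : ℕ, (Fin r → X) → ℂ} (hD : ∀ᵐ z ∂ν, z ∈ D)
    (h : ∀ r (z : Fin r → X), (∀ i, z i ∈ D) → (∏ i, a (z i)) * Φ r z = (∏ i, b (z i)) * Ψ r z) :
    fredholmSum ν a Φ = fredholmSum ν b Ψ := by
  unfold fredholmSum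
  congr 1
  ext r
  congr 1
  refine integral_congr_ae ?_
  filter_upwards [ae_pi_of_ae hD r] with z hz using h r z hz

theorem fredholmSum_sub {Φ Ψ : ∀ r : ℕ, (Fin r → X) → ℂ} {G : X → ℝ}
    (ham : AEStronglyMeasurable a ν)
    (hF : HadamardBound ν Φ F) (hF0 : ∀ z, 0 ≤ F z) (haF : Integrable (fun z => ‖a z‖ * F z) ν)
    (hG : HadamardBound ν Ψ G) (hG0 : ∀ z, 0 ≤ G z) (haG : Integrable (fun z => ‖a z‖ * G z) ν) :
    fredholmSum ν a (fun r z => Φ r z - Ψ r z) = fredholmSum ν a Φ - fredholmSum ν a Ψ := by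
  unfold fredholmSum
  rw [← (hF.summable hF0 haF).tsum_sub (hG.summable hG0 haG)]
  congr 1
  ext r
  rw [← mul_sub, ← integral_sub (hF.integrable ham haF r) (hG.integrable ham haG r)]
  simp only [mul_sub]

omit [MeasurableSpace X] in
theorem kernelDet_sub_kernelCramer (K : X → X → ℂ) (f : X → ℂ) (r : ℕ) (z : Fin r → X) :
    kernelDet K r z - kernelCramer K f r z =
      (Matrix.of fun i j => K (z i) (z j) - f (z i)).det := by
  have := Matrix.det_sub_const_row (Matrix.of fun i j => K (z i) (z j)) (fun i => f (z i))
  simpa [kernelDet, kernelCramer, kernelColDet] using this.symm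

theorem hadamardBound_sub (hD : ∀ᵐ z ∂ν, z ∈ D)
    (hKm : Measurable fun q : X × X => K q.1 q.2)
    (hK : ∀ y ∈ D, ∀ z ∈ D, ‖K y z‖ ≤ F y) (hfm : Measurable f) (hf : ∀ y ∈ D, ‖f y‖ ≤ F y) :
    HadamardBound ν (fun r z => kernelDet K r z - kernelCramer K f r z) (fun z => 2 * F z) where
  meas r := (hadamardBound_kernelDet hD hKm hK).meas r |>.sub
    ((hadamardBound_kernelCramer hD hKm hK hfm hf).meas r)
  bound r := by
    filter_upwards [ae_pi_of_ae hD r] with z hz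
    rw [kernelDet_sub_kernelCramer]
    refine Matrix.norm_det_le _ _ fun i j => (norm_sub_le _ _).trans ?_
    rw [two_mul]
    exact add_le_add (hK _ (hz i) _ (hz j)) (hf _ (hz i))

theorem fredholm_cramer_sub (hD : ∀ᵐ z ∂ν, z ∈ D)
    (hKm : Measurable fun q : X × X => K q.1 q.2)
    (hK : ∀ y ∈ D, ∀ z ∈ D, ‖K y z‖ ≤ F y) (hfm : Measurable f) (hf : ∀ y ∈ D, ‖f y‖ ≤ F y)
    (hF0 : ∀ z, 0 ≤ F z)
    (ham : AEStronglyMeasurable a ν) (ha : Integrable (fun z => ‖a z‖ * F z) ν)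
    (hφm : AEStronglyMeasurable φ ν) (hφ : Integrable (fun z => ‖φ z‖ * F z) ν)
    (heq : ∀ᵐ z' ∂ν, a z' = φ z' + a z' * ∫ y, φ y * K y z' ∂ν) :
    fredholmSum ν a (kernelDet K) * (1 - ∫ y, φ y * f y ∂ν) =
      fredholmSum ν a (fun r z => kernelDet K r z - kernelCramer K f r z) := by
  have h := fredholm_cramer hD hKm hK hfm hf hF0 ham ha hφm hφ (c := 1) (by simpa using heq)
  rw [mul_sub, h, one_mul, mul_one, fredholmSum_sub ham (hadamardBound_kernelDet hD hKm hK) hF0 ha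
    (hadamardBound_kernelCramer hD hKm hK hfm hf) (fun z => by linarith [hF0 z])]
  convert ha.const_mul 2 using 2
  ring

end

/-! ### The tau function and the amplitude equation. -/

namespace DL

variable {p : ℂ} {ζ : SpectralMeasure} {J : Set ℝ} {K : Set ℂ}
  {v : ℤ → ℤ → ℝ → ℂ → ℤ → ℂ} {m n : ℤ} {x : ℝ} {κ : ℂ}

/-- The measure `μ` on the integration domain. -/
noncomputable abbrev SpectralMeasure.ref (ζ : SpectralMeasure) : Measure (ℂ × ℂ) := ζ.μ.restrict ζ.D

/-- The density `w ρ_n(k) σ_n(k')`. -/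
noncomputable def weight (p : ℂ) (ζ : SpectralMeasure) (m n : ℤ) (x : ℝ) (z : ℂ × ℂ) : ℂ :=
  ζ.w z * (rho p m n x z.1 * sigma p m n x z.2)

/-- The Cauchy kernel as a kernel on pairs of spectral parameters. -/
noncomputable def cauchy (z z' : ℂ × ℂ) : ℂ := 1 / (z.1 + z'.2)

theorem measurable_cauchy : Measurable fun q : (ℂ × ℂ) × (ℂ × ℂ) => cauchy q.1 q.2 := by
  unfold cauchy; fun_prop

/-- The factors ρ(k_i) of the rows and σ(k'_j) of the columns leave the determinant and join the
density, so the kernel no longer depends on n₁, n or x₁. -/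
theorem tau_eq_fredholmSum (p : ℂ) (ζ : SpectralMeasure) (m n : ℤ) (x : ℝ) :
    tau p ζ m n x = fredholmSum ζ.ref (weight p ζ m n x) (kernelDet cauchy) := by
  unfold tau fredholmSum
  congr 1
  ext r
  congr 1
  congr 1
  ext z
  have h : (Matrix.of fun i j : Fin r =>
      rho p m n x (z i).1 * Omega (z i).1 (z j).2 * sigma p m n x (z j).2) =
      Matrix.of fun i j => sigma p m n x (z j).2 *
        (Matrix.of fun i j => rho p m n x (z i).1 *
          (Matrix.of fun i j => cauchy (z i) (z j) : Matrix (Fin r) (Fin r) ℂ) i j :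
            Matrix (Fin r) (Fin r) ℂ) i j := by
    ext i j
    simp [cauchy, Omega]
    ring
  rw [h, Matrix.det_mul_row, Matrix.det_mul_column, kernelDet]
  simp only [weight, Finset.prod_mul_distrib]
  ring

theorem Admissible.ae_mem (hζ : Admissible p ζ J) : ∀ᵐ z ∂ζ.ref, z ∈ ζ.D :=
  ae_restrict_mem hζ.measurableSet

theorem Admissible.integrable_weight (hζ : Admissible p ζ J) (m n : ℤ) (hx : x ∈ J) (i j : ℤ) :
    Integrable (fun z => weight p ζ m n x z * (z.1 ^ i * z.2 ^ j)) ζ.ref := by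
  refine (hζ.converges m n x hx i j).congr (.of_forall fun z => ?_)
  simp only [weight, cVec]
  ring

theorem Admissible.integrable_weight' (hζ : Admissible p ζ J) (m n : ℤ) (hx : x ∈ J) :
    Integrable (weight p ζ m n x) ζ.ref := by
  simpa using hζ.integrable_weight m n hx 0 0

theorem Admissible.p_sub_ne (hζ : Admissible p ζ J) {z : ℂ × ℂ} (hz : z ∈ ζ.D) :
    p - z.1 ≠ 0 ∧ p + z.1 ≠ 0 ∧ p - z.2 ≠ 0 ∧ p + z.2 ≠ 0 := by
  obtain ⟨δ, hδ, h⟩ := hζ.separated_p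
  obtain ⟨h1, h2, h3, h4⟩ := h z hz
  refine ⟨fun h => ?_, fun h => ?_, fun h => ?_, fun h => ?_⟩
  · rw [norm_sub_rev, h] at h1; simp at h1; linarith
  · rw [add_comm, h] at h2; simp at h2; linarith
  · rw [norm_sub_rev, h] at h3; simp at h3; linarith
  · rw [add_comm, h] at h4; simp at h4; linarith

theorem sigma_ne_zero (h : κ ≠ 0 ∧ κ ≠ p ∧ κ ≠ -p) : sigma p m n x κ ≠ 0 := by
  have h1 : p + κ ≠ 0 := fun e => h.2.2 (by linear_combination e)
  have h2 : p - κ ≠ 0 := fun e => h.2.1 (by linear_combination -e)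
  exact mul_ne_zero (mul_ne_zero (Complex.exp_ne_zero _) (zpow_ne_zero _ (div_ne_zero h1 h2)))
    (zpow_ne_zero _ (neg_ne_zero.2 h.1))

theorem sigma_sub_one_right (h : κ ≠ 0) : sigma p m (n - 1) x κ = -κ * sigma p m n x κ := by
  unfold sigma
  rw [show -(n - 1) = -n + 1 by ring, zpow_add_one₀ (neg_ne_zero.2 h)]
  ring

theorem rho_sub_one_right {k : ℂ} (h : k ≠ 0) : rho p m (n - 1) x k = rho p m n x k / k := by
  unfold rho
  rw [zpow_sub_one₀ h]
  ring

theorem rho_sub_one_left {k : ℂ} (h : p + k ≠ 0) (h' : p - k ≠ 0) :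
    rho p (m - 1) n x k = rho p m n x k * ((p - k) / (p + k)) := by
  unfold rho
  rw [zpow_sub_one₀ (div_ne_zero h h'), inv_div]
  ring

theorem sigma_sub_one_left (h : p + κ ≠ 0) (h' : p - κ ≠ 0) :
    sigma p (m - 1) n x κ = sigma p m n x κ * ((p - κ) / (p + κ)) := by
  unfold sigma
  rw [zpow_sub_one₀ (div_ne_zero h h'), inv_div]
  ring

theorem weight_sub_one_right {z : ℂ × ℂ} (h : z.1 ≠ 0 ∧ z.2 ≠ 0) :
    weight p ζ m (n - 1) x z = -(z.2 / z.1) * weight p ζ m n x z := by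
  unfold weight
  rw [rho_sub_one_right h.1, sigma_sub_one_right h.2]
  ring

theorem weight_sub_one_left {z : ℂ × ℂ}
    (h : p - z.1 ≠ 0 ∧ p + z.1 ≠ 0 ∧ p - z.2 ≠ 0 ∧ p + z.2 ≠ 0) :
    weight p ζ (m - 1) n x z =
      (p - z.1) / (p + z.1) * ((p - z.2) / (p + z.2)) * weight p ζ m n x z := by
  unfold weight
  rw [rho_sub_one_left h.2.1 h.1, sigma_sub_one_left h.2.2.2 h.2.2.1]
  ring

/-- The adjoint wave function divided by its plane wave factor. -/
noncomputable def amplitude (p : ℂ) (v : ℤ → ℤ → ℝ → ℂ → ℤ → ℂ) (m n : ℤ) (x : ℝ) (κ : ℂ) : ℂ :=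
  v m n x κ 0 / sigma p m n x κ

theorem weight_mul_amplitude (hK : SpectralRange p ζ K) {z : ℂ × ℂ} (hz : z ∈ ζ.D) :
    weight p ζ m n x z * amplitude p v m n x z.2 = ζ.w z * (rho p m n x z.1 * v m n x z.2 0) := by
  have h := sigma_ne_zero (m := m) (n := n) (x := x) (hK.ne z.2 (hK.contains ⟨z, hz, rfl⟩))
  unfold weight amplitude
  field_simp

section solution

variable (hζ : Admissible p ζ J) (hK : SpectralRange p ζ K) (hv : IsAdjointSolution p ζ J K v)
include hζ hK hv

theorem integrable_weight_mul_amplitude (m n : ℤ) (hx : x ∈ J) (i : ℤ) :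
    Integrable (fun z => weight p ζ m n x z * amplitude p v m n x z.2 * z.1 ^ i) ζ.ref := by
  refine (hv.converges_potential m n x hx i 0).congr ?_
  filter_upwards [hζ.ae_mem] with z hz
  rw [weight_mul_amplitude hK hz, cVec]
  ring

theorem integrable_weight_mul_amplitude' (m n : ℤ) (hx : x ∈ J) :
    Integrable (fun z => weight p ζ m n x z * amplitude p v m n x z.2) ζ.ref := by
  simpa using integrable_weight_mul_amplitude hζ hK hv m n hx 0

omit hv in
theorem potential_eq (m n : ℤ) (x : ℝ) :
    potential p ζ v 0 0 m n x = ∫ z, weight p ζ m n x z * amplitude p v m n x z.2 ∂ζ.ref := by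
  unfold potential SpectralMeasure.integral
  refine integral_congr_ae ?_
  filter_upwards [hζ.ae_mem] with z hz
  rw [weight_mul_amplitude hK hz, cVec]
  simp

theorem amplitude_equation (m n : ℤ) (hx : x ∈ J) (hκ : κ ∈ K) :
    amplitude p v m n x κ =
      1 - ∫ z, weight p ζ m n x z * amplitude p v m n x z.2 * (1 / (z.1 + κ)) ∂ζ.ref := by
  have h := sigma_ne_zero (m := m) (n := n) (x := x) (hK.ne κ hκ)
  have he := hv.equation m n x hx κ hκ 0
  have : ζ.integral (fun z => rho p m n x z.1 * Omega z.1 κ * sigma p m n x κ * v m n x z.2 0) =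
      sigma p m n x κ *
        ∫ z, weight p ζ m n x z * amplitude p v m n x z.2 * (1 / (z.1 + κ)) ∂ζ.ref := by
    rw [← integral_const_mul]
    refine integral_congr_ae ?_
    filter_upwards [hζ.ae_mem] with z hz
    rw [weight_mul_amplitude hK hz, Omega]
    ring
  rw [this, cVec, zpow_zero, one_mul] at he
  rw [amplitude, div_eq_iff h]
  linear_combination he

end solution

end DL

/-! ### Uniqueness and the Fredholm series behind τ, u and V. -/

namespace DL

variable {p : ℂ} {ζ : SpectralMeasure} {J : Set ℝ} {K : Set ℂ}
  {v : ℤ → ℤ → ℝ → ℂ → ℤ → ℂ} {m n : ℤ} {x : ℝ} {κ : ℂ}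

theorem norm_one_div_le_of_le {δ : ℝ} (hδ : 0 < δ) {w : ℂ} (h : δ ≤ ‖w‖) : ‖1 / w‖ ≤ 1 / δ := by
  rw [norm_div, norm_one]
  exact one_div_le_one_div_of_le hδ h

theorem Admissible.exists_cauchy_le (hζ : Admissible p ζ J) :
    ∃ C > 0, ∀ z ∈ ζ.D, ∀ z' ∈ ζ.D, ‖cauchy z z'‖ ≤ C := by
  obtain ⟨δ, hδ, h⟩ := hζ.separated
  exact ⟨1 / δ, by positivity, fun z hz z' hz' => norm_one_div_le_of_le hδ (h z hz z' hz')⟩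

theorem SpectralRange.exists_le (hK : SpectralRange p ζ K) (hκ : κ ∈ K) :
    ∃ C > 0, ∀ z ∈ ζ.D, ‖1 / (z.1 + κ)‖ ≤ C := by
  obtain ⟨δ, hδ, h⟩ := hK.separated κ hκ
  exact ⟨1 / δ, by positivity, fun z hz => norm_one_div_le_of_le hδ (h z hz)⟩

theorem measurable_one_div_add (κ : ℂ) : Measurable fun z : ℂ × ℂ => 1 / (z.1 + κ) := by
  fun_prop

section

variable [SigmaFinite ζ.μ]

/-- The homogeneous integral equation has only the trivial solution. -/
theorem homogeneous_eq_zero (hζ : Admissible p ζ J) (hK : SpectralRange p ζ K) (hx : x ∈ J)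
    (hτ : tau p ζ m n x ≠ 0) {Z : ℂ → ℂ}
    (hZ : Integrable (fun z => weight p ζ m n x z * Z z.2) ζ.ref)
    (heq : ∀ κ ∈ K, Z κ = -∫ z, weight p ζ m n x z * Z z.2 * (1 / (z.1 + κ)) ∂ζ.ref) :
    ∀ κ ∈ K, Z κ = 0 := by
  intro κ hκ
  obtain ⟨C, hC, hc⟩ := hζ.exists_cauchy_le
  obtain ⟨C', hC', hc'⟩ := hK.exists_le hκ
  -- With c = 0 and f = 1/(k+κ), Cramer's rule says that τ annihilates the very integral that
  -- represents Z κ.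
  have h := fredholm_cramer (ν := ζ.ref) (D := ζ.D) (K := cauchy) (F := fun _ => C + C')
    (f := fun z => 1 / (z.1 + κ)) (a := weight p ζ m n x) (c := 0)
    (φ := fun z => weight p ζ m n x z * Z z.2)
    hζ.ae_mem measurable_cauchy (fun y hy z hz => (hc y hy z hz).trans (by linarith))
    (measurable_one_div_add κ)
    (fun y hy => (hc' y hy).trans (by linarith)) (fun _ => by positivity)
    (hζ.integrable_weight' m n hx).1 ((hζ.integrable_weight' m n hx).norm.mul_const _)
    hZ.1 (hZ.norm.mul_const _) (by
      filter_upwards [hζ.ae_mem] with z hz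
      conv_rhs => enter [1]; rw [heq z.2 (hK.contains ⟨z, hz, rfl⟩)]
      simp [cauchy])
  rw [zero_mul, ← tau_eq_fredholmSum] at h
  rw [heq κ hκ, (mul_eq_zero.1 h).resolve_left hτ, neg_zero]

section solution

variable (hζ : Admissible p ζ J) (hK : SpectralRange p ζ K) (hv : IsAdjointSolution p ζ J K v)
include hζ hK hv

omit [SigmaFinite ζ.μ] in
theorem ae_amplitude_equation (m n : ℤ) (hx : x ∈ J) : ∀ᵐ z' ∂ζ.ref, weight p ζ m n x z' =
    weight p ζ m n x z' * amplitude p v m n x z'.2 + weight p ζ m n x z' *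
      ∫ y, weight p ζ m n x y * amplitude p v m n x y.2 * cauchy y z' ∂ζ.ref := by
  filter_upwards [hζ.ae_mem] with z hz
  have := amplitude_equation hζ hK hv m n hx (hK.contains ⟨z, hz, rfl⟩)
  unfold cauchy
  linear_combination (-weight p ζ m n x z) * this

/-- The growth 1 + 1/|k| is allowed for f because D need not keep a positive distance from k = 0;
the moments of order -1 still converge. -/
theorem tau_mul_one_sub (m n : ℤ) (hx : x ∈ J) {f : ℂ × ℂ → ℂ} (hf : Measurable f) {C : ℝ}
    (hC : 0 < C) (hfC : ∀ z ∈ ζ.D, ‖f z‖ ≤ C * (1 + ‖z.1⁻¹‖)) :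
    tau p ζ m n x * (1 - ∫ z, weight p ζ m n x z * amplitude p v m n x z.2 * f z ∂ζ.ref) =
      fredholmSum ζ.ref (weight p ζ m n x) fun r z => kernelDet cauchy r z - kernelCramer cauchy f r z := by
  obtain ⟨B, hB, hb⟩ := hζ.exists_cauchy_le
  have h1 := (hζ.integrable_weight' m n hx).norm
  have h2 := (hζ.integrable_weight m n hx (-1) 0).norm
  have h3 := (integrable_weight_mul_amplitude' hζ hK hv m n hx)
  have h4 := (integrable_weight_mul_amplitude hζ hK hv m n hx (-1)).norm
  rw [tau_eq_fredholmSum]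
  refine fredholm_cramer_sub (ν := ζ.ref) (D := ζ.D) (K := cauchy)
    (F := fun z => (B + C) * (1 + ‖z.1⁻¹‖)) hζ.ae_mem measurable_cauchy
    (fun y hy z hz => (hb y hy z hz).trans ?_) hf (fun y hy => (hfC y hy).trans ?_)
    (fun _ => by positivity) (hζ.integrable_weight' m n hx).1 ?_ h3.1 ?_
    (ae_amplitude_equation hζ hK hv m n hx)
  · nlinarith [norm_nonneg y.1⁻¹]
  · gcongr; linarith
  · refine ((h1.add h2).const_mul (B + C)).congr (.of_forall fun z => ?_)
    simp
    ring
  · refine ((h3.norm.add h4).const_mul (B + C)).congr (.of_forall fun z => ?_)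
    simp
    ring

/-- Take f = 1/k: then 1/(k+k') - 1/k = -k'/(k(k+k')), and the row and column factors 1/k_i and
-k'_j are exactly the change of the weight under n ↦ n-1. -/
theorem tau_sub_one_right (m n : ℤ) (hx : x ∈ J) :
    tau p ζ m (n - 1) x = tau p ζ m n x *
      (1 - ∫ z, weight p ζ m n x z * amplitude p v m n x z.2 * z.1 ^ (-1 : ℤ) ∂ζ.ref) := by
  have h := tau_mul_one_sub hζ hK hv m n hx (f := fun z => z.1 ^ (-1 : ℤ))
    (by simp only [zpow_neg_one]; fun_prop) one_pos (fun z _ => by simp)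
  rw [h, tau_eq_fredholmSum]
  refine fredholmSum_congr hζ.ae_mem fun r z hz => ?_
  rw [kernelDet_sub_kernelCramer]
  have h0 := fun i => hζ.ne_zero _ (hz i)
  obtain ⟨δ, hδ, hδ'⟩ := hζ.separated
  have h1 : ∀ i j, (z i).1 + (z j).2 ≠ 0 := fun i j h => by
    have := hδ' _ (hz i) _ (hz j)
    rw [h, norm_zero] at this
    linarith
  have h2 : (Matrix.of fun i j => cauchy (z i) (z j) - (z i).1 ^ (-1 : ℤ)) =
      Matrix.of fun i j => (-(z j).2) * (Matrix.of fun i j => ((z i).1)⁻¹ *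
        (Matrix.of fun i j => cauchy (z i) (z j) : Matrix (Fin r) (Fin r) ℂ) i j :
            Matrix (Fin r) (Fin r) ℂ) i j := by
    ext i j
    have := (h0 i).1
    have := h1 i j
    simp only [Matrix.of_apply, cauchy, zpow_neg_one]
    field_simp
    ring
  rw [h2, Matrix.det_mul_row, Matrix.det_mul_column, kernelDet,
    Finset.prod_congr rfl fun i _ => weight_sub_one_right (h0 i)]
  simp only [← mul_assoc, ← Finset.prod_mul_distrib]
  congr 1
  refine Finset.prod_congr rfl fun i _ => ?_
  ring

/-- Take f = 1: for the Cauchy matrix the sum of Cramer determinants is ∑ (k_i + k'_i) times the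
determinant, which is what ∂₁ produces from the exponentials. -/
theorem tau_mul_potential (m n : ℤ) (hx : x ∈ J) :
    tau p ζ m n x * potential p ζ v 0 0 m n x =
      fredholmSum ζ.ref (weight p ζ m n x)
        fun r z => (∑ i, ((z i).1 + (z i).2)) * kernelDet cauchy r z := by
  obtain ⟨B, hB, hb⟩ := hζ.exists_cauchy_le
  have h3 := (integrable_weight_mul_amplitude' hζ hK hv m n hx)
  have h := fredholm_cramer (ν := ζ.ref) (D := ζ.D) (K := cauchy) (F := fun z => B + 1)
    (f := fun _ => 1) (a := weight p ζ m n x) (c := 1)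
    (φ := fun z => weight p ζ m n x z * amplitude p v m n x z.2) hζ.ae_mem measurable_cauchy
    (fun y hy z hz => (hb y hy z hz).trans (by linarith)) measurable_const
    (fun y hy => by rw [norm_one]; linarith)
    (fun _ => by positivity) (hζ.integrable_weight' m n hx).1
    ((hζ.integrable_weight' m n hx).norm.mul_const _) h3.1 (h3.norm.mul_const _)
    (by simpa using ae_amplitude_equation hζ hK hv m n hx)
  rw [potential_eq hζ hK, tau_eq_fredholmSum]
  simp only [mul_one, one_mul] at h
  rw [h]
  refine fredholmSum_congr hζ.ae_mem fun r z hz => ?_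
  obtain ⟨δ, hδ, hδ'⟩ := hζ.separated
  have h1 : ∀ i j, (z i).1 + (z j).2 ≠ 0 := fun i j h => by
    have := hδ' _ (hz i) _ (hz j)
    rw [h, norm_zero] at this
    linarith
  congr 1
  exact Matrix.sum_det_updateCol_one (Matrix.of fun i j => cauchy (z i) (z j))
    (fun i => (z i).1) (fun i => (z i).2) fun i j => by
      simp [cauchy, h1 i j]

end solution

end

/-! ### Weights and Fredholm series as functions of x₁. -/

section derivative

theorem hasDerivAt_weight (p : ℂ) (ζ : SpectralMeasure) (m n : ℤ) (z : ℂ × ℂ) (x : ℝ) :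
    HasDerivAt (fun x => weight p ζ m n x z) ((z.1 + z.2) * weight p ζ m n x z) x := by
  have h : ∀ k : ℂ, HasDerivAt (fun x : ℝ => Complex.exp (k * x)) (k * Complex.exp (k * x)) x := by
    intro k
    have h1 : HasDerivAt (fun x : ℝ => k * (x : ℂ)) k x := by
      simpa using (Complex.ofRealCLM.hasDerivAt (x := x)).const_mul k
    exact h1.cexp.congr_deriv (mul_comm _ _)
  unfold weight rho sigma
  refine (((((h z.1).mul_const _).mul_const _).mul
    (((h z.2).mul_const _).mul_const _)).const_mul _).congr_deriv ?_
  ring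

theorem weight_eq_exp (p : ℂ) (ζ : SpectralMeasure) (m n : ℤ) (z : ℂ × ℂ) (x y : ℝ) :
    weight p ζ m n x z = Complex.exp ((z.1 + z.2) * (x - y)) * weight p ζ m n y z := by
  have h : ∀ k : ℂ, Complex.exp (k * x) = Complex.exp (k * (x - y)) * Complex.exp (k * y) := by
    intro k
    rw [← Complex.exp_add]
    ring_nf
  unfold weight rho sigma
  rw [h z.1, h z.2, add_mul, Complex.exp_add]
  ring

/-- The sum of the norms of the densities at the ends of an interval dominates the densities on
the interval. -/
noncomputable def weightBound (p : ℂ) (ζ : SpectralMeasure) (m n : ℤ) (x₁ x₂ : ℝ) (z : ℂ × ℂ) : ℝ :=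
  ‖weight p ζ m n x₁ z‖ + ‖weight p ζ m n x₂ z‖

/-- In x₁ the norm is a constant times exp(Re(k+k') x₁), hence monotone. The sign of Re(k+k')
selects the end that dominates. -/
theorem norm_weight_le {x₁ x₂ : ℝ} (hx : x ∈ Set.Ioo x₁ x₂) (z : ℂ × ℂ) :
    ‖weight p ζ m n x z‖ ≤ weightBound p ζ m n x₁ x₂ z := by
  have h : ∀ y : ℝ, ‖Complex.exp ((z.1 + z.2) * (x - y))‖ =
      Real.exp ((z.1 + z.2).re * (x - y)) := fun y => by
    rw [Complex.norm_exp]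
    congr 1
    rw [← Complex.ofReal_sub, Complex.re_mul_ofReal]
  unfold weightBound
  rcases le_total (z.1 + z.2).re 0 with h0 | h0
  · refine le_trans ?_ (le_add_of_nonneg_right (norm_nonneg _))
    rw [weight_eq_exp p ζ m n z x x₁, norm_mul, h]
    exact mul_le_of_le_one_left (norm_nonneg _)
      (Real.exp_le_one_iff.2 (mul_nonpos_of_nonpos_of_nonneg h0 (by linarith [hx.1])))
  · refine le_trans ?_ (le_add_of_nonneg_left (norm_nonneg _))
    rw [weight_eq_exp p ζ m n z x x₂, norm_mul, h]
    exact mul_le_of_le_one_left (norm_nonneg _)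
      (Real.exp_le_one_iff.2 (mul_nonpos_of_nonneg_of_nonpos h0 (by linarith [hx.2])))

/-- One factor 1 + |k+k'| belongs to the Hadamard majorant of the series, the other to its
x₁-derivative. Both are controlled by moments of order at most 2 in each variable. -/
theorem Admissible.integrable_weightBound (hζ : Admissible p ζ J) (m n : ℤ) {x₁ x₂ : ℝ}
    (h₁ : x₁ ∈ J) (h₂ : x₂ ∈ J) :
    Integrable (fun z => weightBound p ζ m n x₁ x₂ z * ((1 + ‖z.1 + z.2‖) * (1 + ‖z.1 + z.2‖)))
      ζ.ref := by
  have h0 : ∀ {y}, y ∈ J → Integrable (fun z => ‖weight p ζ m n y z‖ *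
      ((1 + ‖z.1 + z.2‖) * (1 + ‖z.1 + z.2‖))) ζ.ref := by
    intro y hy
    have hi : ∀ i j : ℕ, Integrable (fun z => ‖weight p ζ m n y z‖ * (‖z.1‖ ^ i * ‖z.2‖ ^ j)) ζ.ref :=
      fun i j => by simpa using (hζ.integrable_weight m n hy i j).norm
    refine Integrable.mono' (g := fun z => ‖weight p ζ m n y z‖ *
      (((1 + ‖z.1‖) * (1 + ‖z.2‖)) * ((1 + ‖z.1‖) * (1 + ‖z.2‖)))) ?_ ?_ (.of_forall fun z => ?_)
    · refine ((((hi 0 0).add ((hi 0 1).const_mul 2)).add (hi 0 2)).add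
        ((((hi 1 0).const_mul 2).add ((hi 1 1).const_mul 4)).add ((hi 1 2).const_mul 2)) |>.add
        (((hi 2 0).add ((hi 2 1).const_mul 2)).add (hi 2 2))).congr (.of_forall fun z => ?_)
      simp only [Pi.add_apply]
      ring
    · exact (hζ.integrable_weight' m n hy).1.norm.mul (by fun_prop)
    · rw [Real.norm_of_nonneg (by positivity)]
      have : 1 + ‖z.1 + z.2‖ ≤ (1 + ‖z.1‖) * (1 + ‖z.2‖) := by
        nlinarith [norm_add_le z.1 z.2, norm_nonneg z.1, norm_nonneg z.2,
          mul_nonneg (norm_nonneg z.1) (norm_nonneg z.2)]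
      gcongr
  refine ((h0 h₁).add (h0 h₂)).congr (.of_forall fun z => ?_)
  simp only [weightBound, Pi.add_apply]
  ring

theorem weightBound_nonneg (x₁ x₂ : ℝ) (z : ℂ × ℂ) : 0 ≤ weightBound p ζ m n x₁ x₂ z := by
  unfold weightBound; positivity

theorem Admissible.aestronglyMeasurable_weightBound (hζ : Admissible p ζ J) (m n : ℤ) {x₁ x₂ : ℝ}
    (h₁ : x₁ ∈ J) (h₂ : x₂ ∈ J) : AEStronglyMeasurable (weightBound p ζ m n x₁ x₂) ζ.ref :=
  (hζ.integrable_weight' m n h₁).1.norm.add (hζ.integrable_weight' m n h₂).1.norm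

theorem Admissible.integrable_weightBound' (hζ : Admissible p ζ J) (m n : ℤ) {x₁ x₂ : ℝ}
    (h₁ : x₁ ∈ J) (h₂ : x₂ ∈ J) :
    Integrable (fun z => weightBound p ζ m n x₁ x₂ z * (1 + ‖z.1 + z.2‖)) ζ.ref := by
  refine (hζ.integrable_weightBound m n h₁ h₂).mono'
    ((hζ.aestronglyMeasurable_weightBound m n h₁ h₂).mul (by fun_prop)) (.of_forall fun z => ?_)
  have := weightBound_nonneg (p := p) (ζ := ζ) (m := m) (n := n) x₁ x₂ z
  rw [Real.norm_of_nonneg (by positivity)]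
  refine mul_le_mul_of_nonneg_left ?_ this
  nlinarith [norm_nonneg (z.1 + z.2)]

/-- Differentiation of Fredholm series in `x₁`. -/
theorem Admissible.hasDerivAt_fredholmSum [SigmaFinite ζ.μ] (hζ : Admissible p ζ J) (m n : ℤ)
    {x₁ x₂ : ℝ} (h₁ : x₁ ∈ J) (h₂ : x₂ ∈ J) (hJ : Set.Ioo x₁ x₂ ⊆ J)
    {Φ : ∀ r : ℕ, (Fin r → ℂ × ℂ) → ℂ} {C : ℝ} (hC : 0 ≤ C)
    (hΦ : HadamardBound ζ.ref Φ fun z => C * (1 + ‖z.1 + z.2‖)) (hx : x ∈ Set.Ioo x₁ x₂) :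
    HasDerivAt (fun x => fredholmSum ζ.ref (weight p ζ m n x) Φ)
      (fredholmSum ζ.ref (weight p ζ m n x) fun r z => (∑ i, ((z i).1 + (z i).2)) * Φ r z) x := by
  refine hΦ.hasDerivAt (fun z => by positivity) (E := fun z => z.1 + z.2) (by fun_prop)
    (α := weightBound p ζ m n x₁ x₂) isOpen_Ioo isPreconnected_Ioo
    (fun y hy => (hζ.integrable_weight' m n (hJ hy)).1)
    (fun y _ z => hasDerivAt_weight p ζ m n z y) (fun y hy z => norm_weight_le hy z)
    (hζ.aestronglyMeasurable_weightBound m n h₁ h₂) ?_ (by fun_prop) hx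
  refine ((hζ.integrable_weightBound m n h₁ h₂).const_mul C).congr (.of_forall fun z => ?_)
  ring

/-- A bound for Fredholm series that is uniform in `x₁`. -/
theorem Admissible.norm_fredholmSum_le [SigmaFinite ζ.μ] (hζ : Admissible p ζ J) (m n : ℤ)
    {x₁ x₂ : ℝ} (h₁ : x₁ ∈ J) (h₂ : x₂ ∈ J) (hJ : Set.Ioo x₁ x₂ ⊆ J) {C : ℝ} (hC : 0 ≤ C) :
    ∃ B > 0, ∀ Φ : ∀ r : ℕ, (Fin r → ℂ × ℂ) → ℂ,
      (HadamardBound ζ.ref Φ fun z => C * (1 + ‖z.1 + z.2‖)) → ∀ x ∈ Set.Ioo x₁ x₂,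
      ‖fredholmSum ζ.ref (weight p ζ m n x) Φ‖ ≤ B := by
  have hi := (hζ.integrable_weightBound' m n h₁ h₂).const_mul C
  have h0 : 0 ≤ ∑' r, fredholmMajorant
    (∫ z, C * (weightBound p ζ m n x₁ x₂ z * (1 + ‖z.1 + z.2‖)) ∂ζ.ref) r :=
    tsum_nonneg fun r => fredholmMajorant_nonneg (integral_nonneg fun z =>
      mul_nonneg hC (mul_nonneg (weightBound_nonneg _ _ z) (by positivity))) r
  refine ⟨(∑' r, fredholmMajorant
    (∫ z, C * (weightBound p ζ m n x₁ x₂ z * (1 + ‖z.1 + z.2‖)) ∂ζ.ref) r) + 1, by linarith,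
    fun Φ hΦ x hx => ?_⟩
  have hle : ∀ z : ℂ × ℂ, ‖weight p ζ m n x z‖ * (C * (1 + ‖z.1 + z.2‖)) ≤
      C * (weightBound p ζ m n x₁ x₂ z * (1 + ‖z.1 + z.2‖)) := fun z => by
    rw [mul_left_comm]
    have := norm_weight_le (p := p) (ζ := ζ) (m := m) (n := n) hx z
    gcongr
  have hi2 : Integrable (fun z : ℂ × ℂ => ‖weight p ζ m n x z‖ * (C * (1 + ‖z.1 + z.2‖))) ζ.ref := by
    refine hi.mono' ((hζ.integrable_weight' m n (hJ hx)).1.norm.mul (by fun_prop))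
      (.of_forall fun z => ?_)
    rw [Real.norm_of_nonneg (by positivity)]
    exact hle z
  refine (hΦ.norm_fredholmSum_le (fun z => by positivity) hi2 (integral_mono hi2 hi hle)).trans ?_
  linarith

end derivative

end DL

/-! ### Differentiability of τ, u and V in x₁. -/

section

open Filter Topology

theorem HadamardBound.mono {X : Type*} [MeasurableSpace X] {ν : Measure X}
    {Φ : ∀ r : ℕ, (Fin r → X) → ℂ} {F G : X → ℝ} (h : HadamardBound ν Φ F) (hF0 : ∀ z, 0 ≤ F z)
    (hFG : ∀ z, F z ≤ G z) : HadamardBound ν Φ G where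
  meas := h.meas
  bound r := by
    filter_upwards [h.bound r] with z hz
    refine hz.trans (mul_le_mul_of_nonneg_left ?_ (by positivity))
    exact Finset.prod_le_prod (fun i _ => hF0 _) fun i _ => hFG _

/-- Pointwise derivatives of a family of measurable functions are measurable. -/
theorem aestronglyMeasurable_of_hasDerivAt {X : Type*} [MeasurableSpace X] {ν : Measure X}
    {G : ℝ → X → ℂ} {G' : X → ℂ} {x₀ : ℝ} (hm : ∀ᶠ x in 𝓝 x₀, AEStronglyMeasurable (G x) ν)
    (hG : ∀ᵐ z ∂ν, HasDerivAt (fun x => G x z) (G' z) x₀) : AEStronglyMeasurable G' ν := by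
  obtain ⟨ε, hε, h⟩ := Metric.eventually_nhds_iff.1 hm
  have hu0 : Tendsto (fun n : ℕ => ε / (n + 2 : ℝ)) atTop (𝓝 0) :=
    tendsto_const_nhds.div_atTop (tendsto_natCast_atTop_atTop.atTop_add tendsto_const_nhds)
  have hu : Tendsto (fun n : ℕ => x₀ + ε / (n + 2 : ℝ)) atTop (𝓝[≠] x₀) := by
    refine tendsto_nhdsWithin_iff.2 ⟨by simpa using hu0.const_add x₀, .of_forall fun n => ?_⟩
    have : 0 < ε / (n + 2 : ℝ) := by positivity
    simp [this.ne']
  refine aestronglyMeasurable_of_tendsto_ae atTop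
    (f := fun (n : ℕ) z => slope (fun x => G x z) x₀ (x₀ + ε / (n + 2 : ℝ))) (fun n => ?_) ?_
  · have h1 : dist (x₀ + ε / (n + 2 : ℝ)) x₀ < ε := by
      rw [Real.dist_eq, add_sub_cancel_left, abs_of_pos (by positivity), div_lt_iff₀ (by positivity)]
      nlinarith
    simp only [slope_def_module]
    exact ((h h1).sub (h (by simpa using hε))).const_smul _
  · filter_upwards [hG] with z hz using (hasDerivAt_iff_tendsto_slope.1 hz).comp hu

namespace DL

variable {p : ℂ} {ζ : SpectralMeasure} {J : Set ℝ} {K : Set ℂ}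
  {v : ℤ → ℤ → ℝ → ℂ → ℤ → ℂ} {m n : ℤ} {x : ℝ} {κ : ℂ}

theorem exists_Ioo_subset (hJ : IsOpen J) (hx : x ∈ J) :
    ∃ x₁ ∈ J, ∃ x₂ ∈ J, x ∈ Set.Ioo x₁ x₂ ∧ Set.Ioo x₁ x₂ ⊆ J := by
  obtain ⟨ε, hε, h⟩ := Metric.isOpen_iff.1 hJ x hx
  have hs : Set.Icc (x - ε / 2) (x + ε / 2) ⊆ J := fun y hy => h (by
    rw [Metric.mem_ball, Real.dist_eq, abs_lt]
    constructor <;> linarith [hy.1, hy.2])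
  exact ⟨x - ε / 2, hs ⟨le_rfl, by linarith⟩, x + ε / 2, hs ⟨by linarith, le_rfl⟩,
    ⟨by linarith, by linarith⟩, Set.Ioo_subset_Icc_self.trans hs⟩

variable [SigmaFinite ζ.μ]

theorem Admissible.exists_hadamardBound (hζ : Admissible p ζ J) : ∃ C > 0,
    HadamardBound ζ.ref (kernelDet cauchy) (fun z => C * (1 + ‖z.1 + z.2‖)) ∧
    HadamardBound ζ.ref (fun r z => (∑ i, ((z i).1 + (z i).2)) * kernelDet cauchy r z)
      (fun z => C * (1 + ‖z.1 + z.2‖)) := by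
  obtain ⟨C, hC, hc⟩ := hζ.exists_cauchy_le
  have h1 := hadamardBound_kernelDet (ν := ζ.ref) (F := fun _ => C) hζ.ae_mem measurable_cauchy hc
  refine ⟨C, hC, h1.mono (fun _ => hC.le) fun z => ?_, ?_⟩
  · nlinarith [norm_nonneg (z.1 + z.2)]
  · exact h1.mul_sum (fun _ => hC.le) (E := fun z => z.1 + z.2) (by fun_prop)

section solution

variable (hJ : IsOpen J) (hζ : Admissible p ζ J) (hK : SpectralRange p ζ K)
  (hv : IsAdjointSolution p ζ J K v)
include hJ hζ hK hv

theorem hasDerivAt_tau (m n : ℤ) (hx : x ∈ J) :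
    HasDerivAt (tau p ζ m n) (tau p ζ m n x * potential p ζ v 0 0 m n x) x := by
  obtain ⟨x₁, h₁, x₂, h₂, hx', hs⟩ := exists_Ioo_subset hJ hx
  obtain ⟨C, hC, hb, -⟩ := hζ.exists_hadamardBound
  rw [tau_mul_potential hζ hK hv m n hx, funext (tau_eq_fredholmSum p ζ m n)]
  exact hζ.hasDerivAt_fredholmSum m n h₁ h₂ hs hC.le hb hx'

theorem continuousOn_potential (m n : ℤ) (hτ : ∀ x ∈ J, tau p ζ m n x ≠ 0) :
    ContinuousOn (potential p ζ v 0 0 m n) J := by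
  have h : ∀ x ∈ J, potential p ζ v 0 0 m n x = fredholmSum ζ.ref (weight p ζ m n x)
      (fun r z => (∑ i, ((z i).1 + (z i).2)) * kernelDet cauchy r z) / tau p ζ m n x :=
    fun x hx => by rw [← tau_mul_potential hζ hK hv m n hx, mul_div_cancel_left₀ _ (hτ x hx)]
  refine ContinuousOn.congr (fun x hx => ContinuousAt.continuousWithinAt ?_) h
  obtain ⟨x₁, h₁, x₂, h₂, hx', hs⟩ := exists_Ioo_subset hJ hx
  obtain ⟨C, hC, -, hb⟩ := hζ.exists_hadamardBound
  exact (hζ.hasDerivAt_fredholmSum m n h₁ h₂ hs hC.le hb hx').continuousAt.div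
    (hasDerivAt_tau hJ hζ hK hv m n hx).continuousAt (hτ x hx)

/-- V is a Fredholm series divided by τ, and τ stays away from 0 near x. What matters is the order
of quantifiers: the neighbourhood is chosen before δ, and B depends on κ only through δ, so one
bound serves all k' occurring in D. -/
theorem amplitude_deriv_bound (m n : ℤ) (hτ : ∀ x ∈ J, tau p ζ m n x ≠ 0) {x₁ x₂ : ℝ}
    (h₁ : x₁ ∈ J) (h₂ : x₂ ∈ J) (hs : Set.Ioo x₁ x₂ ⊆ J) (hx : x ∈ Set.Ioo x₁ x₂) :
    ∃ s ∈ 𝓝 x, s ⊆ Set.Ioo x₁ x₂ ∧ ∀ δ > 0, ∃ B > 0, ∀ κ ∈ K, (∀ z ∈ ζ.D, δ ≤ ‖z.1 + κ‖) →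
      ∀ y ∈ s, DifferentiableAt ℝ (fun y => amplitude p v m n y κ) y ∧
        ‖amplitude p v m n y κ‖ ≤ B ∧ ‖deriv (fun y => amplitude p v m n y κ) y‖ ≤ B := by
  have hcont := (hasDerivAt_tau hJ hζ hK hv m n (hs hx)).continuousAt
  have ht0 : 0 < ‖tau p ζ m n x‖ := norm_pos_iff.2 (hτ x (hs hx))
  set c := ‖tau p ζ m n x‖ / 2 with hc
  have hc0 : 0 < c := by positivity
  have hev : ∀ᶠ y in 𝓝 x, c < ‖tau p ζ m n y‖ :=
    hcont.norm.eventually (lt_mem_nhds (by linarith : c < ‖tau p ζ m n x‖))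
  refine ⟨{y | c < ‖tau p ζ m n y‖} ∩ Set.Ioo x₁ x₂, inter_mem hev (isOpen_Ioo.mem_nhds hx),
    Set.inter_subset_right, fun δ hδ => ?_⟩
  obtain ⟨C, hC, hb⟩ := hζ.exists_cauchy_le
  obtain ⟨C', hC', hb', hb''⟩ := hζ.exists_hadamardBound
  have hM0 : 0 ≤ 2 * (C + 1 / δ) := by positivity
  obtain ⟨B, hB, hB'⟩ := hζ.norm_fredholmSum_le m n h₁ h₂ hs hM0
  obtain ⟨A, hA, hA'⟩ := hζ.norm_fredholmSum_le m n h₁ h₂ hs hC'.le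
  have hu : ∀ y ∈ {y | c < ‖tau p ζ m n y‖} ∩ Set.Ioo x₁ x₂,
      ‖potential p ζ v 0 0 m n y‖ ≤ A / c := by
    rintro y ⟨hy1, hy2⟩
    have h3 := hA' _ hb'' y hy2
    rw [← tau_mul_potential hζ hK hv m n (hs hy2), norm_mul] at h3
    rw [le_div_iff₀ hc0, mul_comm]
    exact (mul_le_mul_of_nonneg_right (le_of_lt hy1) (norm_nonneg _)).trans h3
  refine ⟨B / c + (B / c + B / c * (A / c)), by positivity, fun κ hκ hκδ y hy => ?_⟩
  set Φ : ∀ r : ℕ, (Fin r → ℂ × ℂ) → ℂ := fun r z =>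
    kernelDet cauchy r z - kernelCramer cauchy (fun z => 1 / (z.1 + κ)) r z with hΦ
  have h0 : HadamardBound ζ.ref Φ fun _ => 2 * (C + 1 / δ) :=
    hadamardBound_sub (D := ζ.D) (F := fun _ => C + 1 / δ) hζ.ae_mem measurable_cauchy
      (fun y hy z hz => (hb y hy z hz).trans (le_add_of_nonneg_right (by positivity)))
      (measurable_one_div_add κ)
      (fun z hz => (norm_one_div_le_of_le hδ (hκδ z hz)).trans (le_add_of_nonneg_left hC.le))
  have hΦ1 := h0.mono (fun _ => hM0) (G := fun z => 2 * (C + 1 / δ) * (1 + ‖z.1 + z.2‖))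
    fun z => le_mul_of_one_le_right hM0 (by linarith [norm_nonneg (z.1 + z.2)])
  have hΦ2 := h0.mul_sum (fun _ => hM0) (E := fun z => z.1 + z.2) (by fun_prop)
  have hV : ∀ y ∈ J, amplitude p v m n y κ =
      fredholmSum ζ.ref (weight p ζ m n y) Φ / tau p ζ m n y := fun y hy => by
    have := tau_mul_one_sub hζ hK hv m n hy (measurable_one_div_add κ) (C := 1 / δ)
      (by positivity) (fun z hz => (norm_one_div_le_of_le hδ (hκδ z hz)).trans
        (le_mul_of_one_le_right (by positivity) (by linarith [norm_nonneg z.1⁻¹])))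
    rw [← amplitude_equation hζ hK hv m n hy hκ] at this
    rw [eq_div_iff (hτ y hy), mul_comm, this]
  have hyJ := hs hy.2
  have hN := hζ.hasDerivAt_fredholmSum m n h₁ h₂ hs hM0 hΦ1 hy.2
  have hd := hN.div (hasDerivAt_tau hJ hζ hK hv m n hyJ) (hτ y hyJ)
  have hVd := hd.congr_of_eventuallyEq
    (f₁ := fun y => amplitude p v m n y κ) (by
      filter_upwards [hJ.mem_nhds hyJ] with y hy using hV y hy)
  have hVle : ‖amplitude p v m n y κ‖ ≤ B / c := by
    rw [hV y hyJ, norm_div]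
    exact div_le_div₀ hB.le (hB' Φ hΦ1 y hy.2) hc0 (le_of_lt hy.1)
  refine ⟨hVd.differentiableAt, hVle.trans (le_add_of_nonneg_right (by positivity)), ?_⟩
  rw [hVd.deriv]
  -- Quotient rule with ∂₁τ = τu: the derivative of V is the differentiated series over τ, minus uV.
  have he : (fredholmSum ζ.ref (weight p ζ m n y) (fun r z => (∑ i, ((z i).1 + (z i).2)) * Φ r z) *
      tau p ζ m n y - fredholmSum ζ.ref (weight p ζ m n y) Φ *
        (tau p ζ m n y * potential p ζ v 0 0 m n y)) / tau p ζ m n y ^ 2 =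
      fredholmSum ζ.ref (weight p ζ m n y) (fun r z => (∑ i, ((z i).1 + (z i).2)) * Φ r z) /
        tau p ζ m n y - amplitude p v m n y κ * potential p ζ v 0 0 m n y := by
    rw [hV y hyJ]
    have := hτ y hyJ
    field_simp
  rw [he]
  refine (norm_sub_le _ _).trans ?_
  have h5 : ‖fredholmSum ζ.ref (weight p ζ m n y) (fun r z => (∑ i, ((z i).1 + (z i).2)) * Φ r z) /
        tau p ζ m n y‖ ≤ B / c := by
    rw [norm_div]
    exact div_le_div₀ hB.le (hB' _ hΦ2 y hy.2) hc0 (le_of_lt hy.1)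
  have h6 : ‖amplitude p v m n y κ * potential p ζ v 0 0 m n y‖ ≤ B / c * (A / c) := by
    rw [norm_mul]
    exact mul_le_mul hVle (hu y hy) (norm_nonneg _) (by positivity)
  have : 0 < B / c := by positivity
  linarith

end solution

end DL

end

/-! ### The x₁-equation of the adjoint Lax pair. -/

section

open Filter Topology

theorem integral_eq_linear_combination {X : Type*} [MeasurableSpace X] {ν : Measure X}
    {f₁ f₂ f₃ f₄ h : X → ℂ} (h₁ : Integrable f₁ ν) (h₂ : Integrable f₂ ν) (h₃ : Integrable f₃ ν)
    (h₄ : Integrable f₄ ν) (c₁ c₂ c₃ c₄ : ℂ)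
    (hh : ∀ᵐ z ∂ν, h z = c₁ * f₁ z + c₂ * f₂ z + c₃ * f₃ z + c₄ * f₄ z) :
    ∫ z, h z ∂ν = c₁ * ∫ z, f₁ z ∂ν + c₂ * ∫ z, f₂ z ∂ν + c₃ * ∫ z, f₃ z ∂ν + c₄ * ∫ z, f₄ z ∂ν := by
  have i₁ := h₁.const_mul c₁
  have i₂ := h₂.const_mul c₂
  have i₃ := h₃.const_mul c₃
  have i₄ := h₄.const_mul c₄
  have i₁₂ : Integrable (fun z => c₁ * f₁ z + c₂ * f₂ z) ν := i₁.add i₂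
  have i₁₃ : Integrable (fun z => c₁ * f₁ z + c₂ * f₂ z + c₃ * f₃ z) ν := i₁₂.add i₃
  rw [integral_congr_ae hh, integral_add i₁₃ i₄, integral_add i₁₂ i₃, integral_add i₁ i₂]
  simp only [integral_const_mul]

namespace DL

variable {p : ℂ} {ζ : SpectralMeasure} {J : Set ℝ} {K : Set ℂ}
  {v : ℤ → ℤ → ℝ → ℂ → ℤ → ℂ} {m n : ℤ} {x : ℝ} {κ : ℂ}

theorem Integrable.mul_one_div_add (hζ : Admissible p ζ J) (hK : SpectralRange p ζ K) (hκ : κ ∈ K)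
    {h : ℂ × ℂ → ℂ} (hh : Integrable h ζ.ref) :
    Integrable (fun z => h z * (1 / (z.1 + κ))) ζ.ref := by
  obtain ⟨C, hC, hc⟩ := hK.exists_le hκ
  refine hh.mul_bdd (c := C) (measurable_one_div_add κ).aestronglyMeasurable ?_
  filter_upwards [hζ.ae_mem] with z hz using hc z hz

theorem SpectralRange.add_ne_zero (hK : SpectralRange p ζ K) (hκ : κ ∈ K) {z : ℂ × ℂ}
    (hz : z ∈ ζ.D) : z.1 + κ ≠ 0 := by
  obtain ⟨δ, hδ, h⟩ := hK.separated κ hκ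
  intro h0
  have := h z hz
  rw [h0, norm_zero] at this
  linarith

variable [SigmaFinite ζ.μ] (hJ : IsOpen J) (hζ : Admissible p ζ J) (hK : SpectralRange p ζ K)
  (hv : IsAdjointSolution p ζ J K v)
include hJ hζ hK hv

/-- The integral equation differentiated with respect to `x₁`. -/
theorem amplitude_deriv_equation (m n : ℤ) (hτ : ∀ x ∈ J, tau p ζ m n x ≠ 0) (hx : x ∈ J) :
    Integrable (fun z => weight p ζ m n x z * (z.2 * amplitude p v m n x z.2)) ζ.ref ∧
    Integrable (fun z => weight p ζ m n x z * deriv (fun y => amplitude p v m n y z.2) x) ζ.ref ∧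
    ∀ κ ∈ K, DifferentiableAt ℝ (fun y => amplitude p v m n y κ) x ∧
      deriv (fun y => amplitude p v m n y κ) x =
        -∫ z, ((z.1 + z.2) * weight p ζ m n x z * amplitude p v m n x z.2 +
          weight p ζ m n x z * deriv (fun y => amplitude p v m n y z.2) x) *
            (1 / (z.1 + κ)) ∂ζ.ref := by
  obtain ⟨x₁, h₁, x₂, h₂, hx', hs⟩ := exists_Ioo_subset hJ hx
  obtain ⟨s, hsx, hsI, hsB⟩ := amplitude_deriv_bound hJ hζ hK hv m n hτ h₁ h₂ hs hx'
  obtain ⟨δ, hδ, hδD⟩ := hζ.separated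
  -- The separation constant of D makes the bounds hold simultaneously at every κ = k' under the
  -- integral sign.
  obtain ⟨B, hB, hb⟩ := hsB δ hδ
  have hbD : ∀ z ∈ ζ.D, ∀ y ∈ s, DifferentiableAt ℝ (fun y => amplitude p v m n y z.2) y ∧
        ‖amplitude p v m n y z.2‖ ≤ B ∧ ‖deriv (fun y => amplitude p v m n y z.2) y‖ ≤ B :=
    fun z hz => hb z.2 (hK.contains ⟨z, hz, rfl⟩) fun z' hz' => hδD z' hz' z hz
  have hxs : x ∈ s := mem_of_mem_nhds hsx
  have hαi := hζ.integrable_weightBound' m n h₁ h₂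
  have hm : ∀ᶠ y in 𝓝 x, AEStronglyMeasurable
      (fun z => weight p ζ m n y z * amplitude p v m n y z.2) ζ.ref := by
    filter_upwards [hJ.mem_nhds hx] with y hy
    exact (integrable_weight_mul_amplitude' hζ hK hv m n hy).1
  have hd : ∀ z ∈ ζ.D, ∀ y ∈ s, HasDerivAt
      (fun y => weight p ζ m n y z * amplitude p v m n y z.2)
      ((z.1 + z.2) * weight p ζ m n y z * amplitude p v m n y z.2 +
          weight p ζ m n y z * deriv (fun y => amplitude p v m n y z.2) y) y :=
    fun z hz y hy => (hasDerivAt_weight p ζ m n z y).mul (hbD z hz y hy).1.hasDerivAt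
  have hm' := aestronglyMeasurable_of_hasDerivAt hm
    (by filter_upwards [hζ.ae_mem] with z hz using hd z hz x hxs)
  have hle : ∀ z ∈ ζ.D, ∀ y ∈ s, ‖(z.1 + z.2) * weight p ζ m n y z * amplitude p v m n y z.2 +
      weight p ζ m n y z * deriv (fun y => amplitude p v m n y z.2) y‖ ≤
      B * (weightBound p ζ m n x₁ x₂ z * (1 + ‖z.1 + z.2‖)) := by
    intro z hz y hy
    obtain ⟨-, hb1, hb2⟩ := hbD z hz y hy
    have hw := norm_weight_le (p := p) (ζ := ζ) (m := m) (n := n) (hsI hy) z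
    have hw0 := weightBound_nonneg (p := p) (ζ := ζ) (m := m) (n := n) x₁ x₂ z
    calc _ ≤ ‖z.1 + z.2‖ * ‖weight p ζ m n y z‖ * ‖amplitude p v m n y z.2‖ +
          ‖weight p ζ m n y z‖ * ‖deriv (fun y => amplitude p v m n y z.2) y‖ := by
          refine (norm_add_le _ _).trans (le_of_eq ?_)
          simp only [norm_mul]
      _ ≤ ‖z.1 + z.2‖ * weightBound p ζ m n x₁ x₂ z * B + weightBound p ζ m n x₁ x₂ z * B := by
          gcongr
      _ = _ := by ring
  have hi1 : Integrable (fun z => weight p ζ m n x z * (z.2 * amplitude p v m n x z.2)) ζ.ref := by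
    refine Integrable.mono' (g := fun z => B * (‖weight p ζ m n x z * (z.1 ^ (0 : ℤ) * z.2 ^ (1 : ℤ))‖))
      ((hζ.integrable_weight m n hx 0 1).norm.const_mul B) ?_ ?_
    · refine ((integrable_weight_mul_amplitude' hζ hK hv m n hx).1.mul
        (measurable_snd.aestronglyMeasurable)).congr (.of_forall fun z => ?_)
      simp only [Pi.mul_apply]
      ring
    · filter_upwards [hζ.ae_mem] with z hz
      have := (hbD z hz x hxs).2.1
      rw [zpow_zero, zpow_one, one_mul, ← mul_assoc, norm_mul, mul_comm]
      gcongr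
  have hi2 : Integrable (fun z => weight p ζ m n x z *
      deriv (fun y => amplitude p v m n y z.2) x) ζ.ref := by
    refine Integrable.mono' (g := fun z => B * ‖weight p ζ m n x z‖)
      ((hζ.integrable_weight' m n hx).norm.const_mul B) ?_ ?_
    -- Measurability of the derivative of V in k' is not given. It is recovered by subtracting the
    -- explicit term from the derivative of the whole integrand, a limit of difference quotients.
    · have h3 : AEStronglyMeasurable
          (fun z => (z.1 + z.2) * (weight p ζ m n x z * amplitude p v m n x z.2)) ζ.ref :=
        AEStronglyMeasurable.mul (by fun_prop)
          (integrable_weight_mul_amplitude' hζ hK hv m n hx).1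
      refine (hm'.sub h3).congr (.of_forall fun z => ?_)
      simp only [Pi.sub_apply]
      ring
    · filter_upwards [hζ.ae_mem] with z hz
      have := (hbD z hz x hxs).2.2
      rw [norm_mul, mul_comm]
      gcongr
  refine ⟨hi1, hi2, fun κ hκ => ?_⟩
  obtain ⟨C, hC, hc⟩ := hK.exists_le hκ
  have hint := (hasDerivAt_integral_of_dominated_loc_of_deriv_le (μ := ζ.ref) (s := s)
    (bound := fun z => B * (weightBound p ζ m n x₁ x₂ z * (1 + ‖z.1 + z.2‖)) * C)
    (F := fun y z => weight p ζ m n y z * amplitude p v m n y z.2 * (1 / (z.1 + κ)))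
    (F' := fun y z => ((z.1 + z.2) * weight p ζ m n y z * amplitude p v m n y z.2 +
          weight p ζ m n y z * deriv (fun y => amplitude p v m n y z.2) y) * (1 / (z.1 + κ)))
    hsx (hm.mono fun y hy => hy.mul (measurable_one_div_add κ).aestronglyMeasurable)
    (Integrable.mul_one_div_add hζ hK hκ (integrable_weight_mul_amplitude' hζ hK hv m n hx))
    (hm'.mul (measurable_one_div_add κ).aestronglyMeasurable)
    (by
      filter_upwards [hζ.ae_mem] with z hz y hy
      rw [norm_mul]
      exact mul_le_mul (hle z hz y hy) (hc z hz) (norm_nonneg _)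
        ((norm_nonneg _).trans (hle z hz y hy)))
    ((hαi.const_mul B).mul_const C)
    (by filter_upwards [hζ.ae_mem] with z hz y hy using (hd z hz y hy).mul_const _)).2
  have hV : HasDerivAt (fun y => amplitude p v m n y κ)
      (-∫ z, ((z.1 + z.2) * weight p ζ m n x z * amplitude p v m n x z.2 +
          weight p ζ m n x z * deriv (fun y => amplitude p v m n y z.2) x) *
            (1 / (z.1 + κ)) ∂ζ.ref) x := by
    refine (hint.const_sub 1).congr_of_eventuallyEq ?_
    filter_upwards [hJ.mem_nhds hx] with y hy
    exact amplitude_equation hζ hK hv m n hy hκ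
  exact ⟨hV.differentiableAt, hV.deriv⟩

/-- The evolution of the amplitude in `x₁`. -/
theorem hasDerivAt_amplitude (m n : ℤ) (hτ : ∀ x ∈ J, tau p ζ m n x ≠ 0) (hx : x ∈ J) (hκ : κ ∈ K) :
    HasDerivAt (fun y => amplitude p v m n y κ)
      (κ * amplitude p v m (n - 1) x κ - κ * amplitude p v m n x κ +
        (potential p ζ v 0 0 m (n - 1) x - potential p ζ v 0 0 m n x) * amplitude p v m n x κ) x := by
  obtain ⟨hi1, hi2, h⟩ := amplitude_deriv_equation hJ hζ hK hv m n hτ hx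
  set u := potential p ζ v 0 0 m n x with hu
  set u' := potential p ζ v 0 0 m (n - 1) x with hu'
  set V := amplitude p v m n x with hVdef
  set V' := amplitude p v m (n - 1) x with hVdef'
  set W : ℂ → ℂ := fun κ => deriv (fun y => amplitude p v m n y κ) x with hW
  have hi3 := integrable_weight_mul_amplitude' hζ hK hv m n hx
  have hi4 := integrable_weight_mul_amplitude' hζ hK hv m (n - 1) hx
  have hi5 := integrable_weight_mul_amplitude hζ hK hv m (n - 1) hx 1
  -- The shift of n trades k' for -k, which can then be divided by k+κ.
  have hshift : ∀ z ∈ ζ.D, weight p ζ m n x z * (z.2 * V' z.2) =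
      -(weight p ζ m (n - 1) x z * V' z.2 * z.1 ^ (1 : ℤ)) := fun z hz => by
    have := (hζ.ne_zero z hz).1
    rw [weight_sub_one_right (hζ.ne_zero z hz), zpow_one]
    field_simp
  have hi6 : Integrable (fun z => weight p ζ m n x z * (z.2 * V' z.2)) ζ.ref := by
    refine hi5.neg.congr ?_
    filter_upwards [hζ.ae_mem] with z hz
    rw [hshift z hz]
    rfl
  -- Z is the defect of the asserted evolution equation.
  have e := homogeneous_eq_zero (m := m) (n := n) hζ hK hx (hτ x hx)
    (Z := fun κ => W κ + κ * V κ - κ * V' κ - (u' - u) * V κ) ?_ ?_ κ hκ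
  · obtain ⟨h1, h2⟩ := h κ hκ
    refine h1.hasDerivAt.congr_deriv ?_
    simp only [hW] at e
    linear_combination e
  · refine (((hi2.add hi1).sub hi6).sub (hi3.const_mul (u' - u))).congr (.of_forall fun z => ?_)
    simp only [Pi.add_apply, Pi.sub_apply]
    ring
  · intro κ hκ
    have hV : V κ = _ := amplitude_equation hζ hK hv m n hx hκ
    have hV' : V' κ = _ := amplitude_equation hζ hK hv m (n - 1) hx hκ
    have hpot := potential_eq hζ hK (v := v) m n x
    have hpot' := potential_eq hζ hK (v := v) m (n - 1) x
    obtain ⟨-, hd⟩ := h κ hκ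
    have J1 := Integrable.mul_one_div_add hζ hK hκ hi1
    have J2 := Integrable.mul_one_div_add hζ hK hκ hi2
    have J3 := Integrable.mul_one_div_add hζ hK hκ hi3
    have J4 := Integrable.mul_one_div_add hζ hK hκ hi4
    have J6 := Integrable.mul_one_div_add hζ hK hκ hi6
    -- Split k + k' = (k + κ) + (k' - κ): the first bracket cancels the kernel and leaves u.
    have e1 : ∫ z, ((z.1 + z.2) * weight p ζ m n x z * V z.2 + weight p ζ m n x z * W z.2) *
        (1 / (z.1 + κ)) ∂ζ.ref =
        u + ∫ z, weight p ζ m n x z * (z.2 * V z.2) * (1 / (z.1 + κ)) ∂ζ.ref - κ * (1 - V κ) +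
        ∫ z, weight p ζ m n x z * W z.2 * (1 / (z.1 + κ)) ∂ζ.ref := by
      rw [hV, sub_sub_cancel, hu, hpot]
      refine (integral_eq_linear_combination hi3 J1 J3 J2 1 1 (-κ) 1 ?_).trans (by ring)
      filter_upwards [hζ.ae_mem] with z hz
      have := hK.add_ne_zero hκ hz
      field_simp
      ring
    have e2 : ∫ z, weight p ζ m n x z * (z.2 * V' z.2) * (1 / (z.1 + κ)) ∂ζ.ref =
        κ * (1 - V' κ) - u' := by
      rw [hV', sub_sub_cancel, hu', hpot']
      refine (integral_eq_linear_combination J4 hi4 hi4 hi4 κ (-1) 0 0 ?_).trans (by ring)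
      filter_upwards [hζ.ae_mem] with z hz
      have := hK.add_ne_zero hκ hz
      rw [hshift z hz, zpow_one]
      field_simp
      ring
    have e3 : ∫ z, weight p ζ m n x z * (W z.2 + z.2 * V z.2 - z.2 * V' z.2 - (u' - u) * V z.2) *
        (1 / (z.1 + κ)) ∂ζ.ref =
        ∫ z, weight p ζ m n x z * W z.2 * (1 / (z.1 + κ)) ∂ζ.ref +
        ∫ z, weight p ζ m n x z * (z.2 * V z.2) * (1 / (z.1 + κ)) ∂ζ.ref -
        ∫ z, weight p ζ m n x z * (z.2 * V' z.2) * (1 / (z.1 + κ)) ∂ζ.ref -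
        (u' - u) * (1 - V κ) := by
      rw [hV, sub_sub_cancel]
      refine (integral_eq_linear_combination J2 J1 J6 J3 1 1 (-1) (-(u' - u))
        (.of_forall fun z => ?_)).trans (by ring)
      ring
    rw [e3, e2]
    have hd' : W κ = _ := hd
    rw [e1] at hd'
    linear_combination hd'

theorem adLaxA (hτ : ∀ m n : ℤ, ∀ x ∈ J, tau p ζ m n x ≠ 0) (hκ : κ ∈ K) :
    AdLaxA J (potential p ζ v 0 0) (fun m n x => v m n x κ 0) := by
  intro m n x hx
  have hσ : ∀ n y, sigma p m n y κ ≠ 0 := fun n y => sigma_ne_zero (hK.ne κ hκ)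
  have hv0 : ∀ n y, v m n y κ 0 = sigma p m n y κ * amplitude p v m n y κ := fun n y => by
    rw [amplitude, mul_div_cancel₀ _ (hσ n y)]
  have hs : HasDerivAt (fun y => sigma p m n y κ) (κ * sigma p m n x κ) x := by
    have h1 : HasDerivAt (fun y : ℝ => κ * (y : ℂ)) κ x := by
      simpa using (Complex.ofRealCLM.hasDerivAt (x := x)).const_mul κ
    unfold sigma
    refine ((h1.cexp.mul_const _).mul_const _).congr_deriv ?_
    ring
  have h := hs.mul (hasDerivAt_amplitude hJ hζ hK hv m n (hτ m n) hx hκ)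
  simp only [hv0]
  refine h.congr_deriv ?_
  rw [sigma_sub_one_right (hK.ne κ hκ).1]
  ring

end DL

end

/-! ### The n₁-shift and the four-term relation of amplitudes. -/

section

open Filter Topology

namespace DL

variable {p : ℂ} {ζ : SpectralMeasure} {J : Set ℝ} {K : Set ℂ}
  {v : ℤ → ℤ → ℝ → ℂ → ℤ → ℂ} {m n : ℤ} {x : ℝ} {κ : ℂ}

/-- The functional `R ↦ ∬_D dζ(k, k') ρ_n(k) σ_n(k') k⁻¹ R(k')`. -/
noncomputable def invMoment (p : ℂ) (ζ : SpectralMeasure) (m n : ℤ) (x : ℝ) (R : ℂ → ℂ) : ℂ :=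
  ∫ z, weight p ζ m n x z * R z.2 * z.1⁻¹ ∂ζ.ref

/-- `R` solves the integral equation of the amplitudes with right-hand side `g`. -/
structure IsSolution (p : ℂ) (ζ : SpectralMeasure) (K : Set ℂ) (m n : ℤ) (x : ℝ) (R g : ℂ → ℂ) :
    Prop where
  integrable : Integrable (fun z => weight p ζ m n x z * R z.2) ζ.ref
  integrable_inv : Integrable (fun z => weight p ζ m n x z * R z.2 * z.1⁻¹) ζ.ref
  equation : ∀ κ ∈ K, R κ = g κ - ∫ z, weight p ζ m n x z * R z.2 * (1 / (z.1 + κ)) ∂ζ.ref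

theorem IsSolution.linear_combination (hζ : Admissible p ζ J) (hK : SpectralRange p ζ K)
    {R₁ R₂ g₁ g₂ : ℂ → ℂ} (h₁ : IsSolution p ζ K m n x R₁ g₁) (h₂ : IsSolution p ζ K m n x R₂ g₂)
    (c₁ c₂ : ℂ) :
    IsSolution p ζ K m n x (fun κ => c₁ * R₁ κ + c₂ * R₂ κ) (fun κ => c₁ * g₁ κ + c₂ * g₂ κ) ∧
    invMoment p ζ m n x (fun κ => c₁ * R₁ κ + c₂ * R₂ κ) =
      c₁ * invMoment p ζ m n x R₁ + c₂ * invMoment p ζ m n x R₂ := by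
  have i₁ := h₁.integrable
  have j₁ := h₁.integrable_inv
  refine ⟨⟨?_, ?_, fun κ hκ => ?_⟩, ?_⟩
  · refine ((i₁.const_mul c₁).add (h₂.integrable.const_mul c₂)).congr (.of_forall fun z => ?_)
    simp only [Pi.add_apply]
    ring
  · refine ((j₁.const_mul c₁).add (h₂.integrable_inv.const_mul c₂)).congr (.of_forall fun z => ?_)
    simp only [Pi.add_apply]
    ring
  · have k₁ := Integrable.mul_one_div_add hζ hK hκ i₁
    have k₂ := Integrable.mul_one_div_add hζ hK hκ h₂.integrable
    rw [integral_eq_linear_combination k₁ k₂ k₂ k₂ c₁ c₂ 0 0 (.of_forall fun z => by ring)]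
    linear_combination c₁ * h₁.equation κ hκ + c₂ * h₂.equation κ hκ
  · unfold invMoment
    rw [integral_eq_linear_combination j₁ h₂.integrable_inv j₁ j₁ c₁ c₂ 0 0
      (.of_forall fun z => by ring)]
    ring

theorem IsSolution.eq_zero [SigmaFinite ζ.μ] (hζ : Admissible p ζ J) (hK : SpectralRange p ζ K)
    (hx : x ∈ J) (hτ : tau p ζ m n x ≠ 0) {R g : ℂ → ℂ} (h : IsSolution p ζ K m n x R g)
    (hg : ∀ κ ∈ K, g κ = 0) : (∀ κ ∈ K, R κ = 0) ∧ invMoment p ζ m n x R = 0 := by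
  have h0 := homogeneous_eq_zero hζ hK hx hτ h.integrable fun κ hκ => by
    rw [h.equation κ hκ, hg κ hκ, zero_sub]
  refine ⟨h0, integral_eq_zero_of_ae ?_⟩
  filter_upwards [hζ.ae_mem] with z hz
  simp [h0 z.2 (hK.contains ⟨z, hz, rfl⟩)]

section solution

variable (hζ : Admissible p ζ J) (hK : SpectralRange p ζ K) (hv : IsAdjointSolution p ζ J K v)
include hζ hK hv

theorem isSolution_amplitude (m n : ℤ) (hx : x ∈ J) :
    IsSolution p ζ K m n x (amplitude p v m n x) fun _ => 1 where
  integrable := integrable_weight_mul_amplitude' hζ hK hv m n hx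
  integrable_inv := by simpa using integrable_weight_mul_amplitude hζ hK hv m n hx (-1)
  equation κ hκ := amplitude_equation hζ hK hv m n hx hκ

theorem tau_mul_invMoment [SigmaFinite ζ.μ] (m n : ℤ) (hx : x ∈ J) :
    tau p ζ m (n - 1) x = tau p ζ m n x *
      (1 - invMoment p ζ m n x (amplitude p v m n x)) := by
  simpa [invMoment] using tau_sub_one_right hζ hK hv m n hx

/-- The effect on the integral equation of a backward shift of `n`. -/
theorem isSolution_sub_one_right (m n : ℤ) (hx : x ∈ J) :
    IsSolution p ζ K m n x (fun κ => -κ * amplitude p v m (n - 1) x κ)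
      (fun κ => -κ + potential p ζ v 0 0 m (n - 1) x) ∧
    invMoment p ζ m n x (fun κ => -κ * amplitude p v m (n - 1) x κ) =
      potential p ζ v 0 0 m (n - 1) x := by
  have hi := integrable_weight_mul_amplitude' hζ hK hv m (n - 1) hx
  have hshift : ∀ z ∈ ζ.D, weight p ζ m n x z * (-z.2 * amplitude p v m (n - 1) x z.2) =
      weight p ζ m (n - 1) x z * amplitude p v m (n - 1) x z.2 * z.1 := fun z hz => by
    have := (hζ.ne_zero z hz).1
    rw [weight_sub_one_right (hζ.ne_zero z hz)]
    field_simp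
  have hshift' : ∀ z ∈ ζ.D, weight p ζ m n x z * (-z.2 * amplitude p v m (n - 1) x z.2) * z.1⁻¹ =
      weight p ζ m (n - 1) x z * amplitude p v m (n - 1) x z.2 := fun z hz => by
    have := (hζ.ne_zero z hz).1
    rw [hshift z hz]
    field_simp
  refine ⟨⟨?_, ?_, fun κ hκ => ?_⟩, ?_⟩
  · refine (integrable_weight_mul_amplitude hζ hK hv m (n - 1) hx 1).congr ?_
    filter_upwards [hζ.ae_mem] with z hz
    rw [hshift z hz, zpow_one]
  · refine hi.congr ?_
    filter_upwards [hζ.ae_mem] with z hz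
    rw [hshift' z hz]
  · have hj := Integrable.mul_one_div_add hζ hK hκ hi
    rw [integral_eq_linear_combination hi hj hj hj 1 (-κ) 0 0, ← potential_eq hζ hK]
    · linear_combination (-κ) * amplitude_equation hζ hK hv m (n - 1) hx hκ
    · filter_upwards [hζ.ae_mem] with z hz
      have := hK.add_ne_zero hκ hz
      rw [hshift z hz]
      field_simp
      ring
  · rw [potential_eq hζ hK]
    refine integral_congr_ae ?_
    filter_upwards [hζ.ae_mem] with z hz using hshift' z hz

end solution

/-- The effect on the integral equation of a backward shift of `n₁`. -/
theorem IsSolution.sub_one_left (hζ : Admissible p ζ J) (hK : SpectralRange p ζ K) {R g : ℂ → ℂ}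
    (h : IsSolution p ζ K (m - 1) n x R g) : ∃ c : ℂ,
    IsSolution p ζ K m n x (fun κ => (p - κ) / (p + κ) * R κ)
      (fun κ => (p - κ) / (p + κ) * g κ - 2 * p / (p + κ) * c) ∧
    invMoment p ζ m n x (fun κ => (p - κ) / (p + κ) * R κ) =
      invMoment p ζ (m - 1) n x R - 2 * c := by
  obtain ⟨δ, hδ, hδp⟩ := hζ.separated_p
  have hbd : ∀ᵐ z ∂ζ.ref, ‖(p - z.1)⁻¹‖ ≤ 1 / δ := by
    filter_upwards [hζ.ae_mem] with z hz
    rw [← one_div]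
    exact norm_one_div_le_of_le hδ (norm_sub_rev z.1 p ▸ (hδp z hz).1)
  have hm : Measurable fun z : ℂ × ℂ => (p - z.1)⁻¹ := by fun_prop
  have hi := h.integrable.mul_bdd hm.aestronglyMeasurable hbd
  have hshift : ∀ z ∈ ζ.D, weight p ζ m n x z * ((p - z.2) / (p + z.2) * R z.2) =
      weight p ζ (m - 1) n x z * R z.2 * ((p + z.1) * (p - z.1)⁻¹) := fun z hz => by
    obtain ⟨h1, h2, h3, h4⟩ := hζ.p_sub_ne hz
    rw [weight_sub_one_left ⟨h1, h2, h3, h4⟩]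
    field_simp
  have hshift' : ∀ z ∈ ζ.D,
      weight p ζ m n x z * ((p - z.2) / (p + z.2) * R z.2) * z.1⁻¹ =
      1 * (weight p ζ (m - 1) n x z * R z.2 * z.1⁻¹) +
        2 * (weight p ζ (m - 1) n x z * R z.2 * (p - z.1)⁻¹) := fun z hz => by
    have h0 := (hζ.ne_zero z hz).1
    have h1 := (hζ.p_sub_ne hz).1
    rw [hshift z hz]
    field_simp
    ring
  -- The partial fraction (p+k)/((p-k)(k+κ)) = ((p-κ)/(p+κ))/(k+κ) + (2p/(p+κ))/(p-k) leaves this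
  -- moment as the only new unknown. It is independent of κ.
  refine ⟨-∫ z, weight p ζ (m - 1) n x z * R z.2 * (p - z.1)⁻¹ ∂ζ.ref,
    ⟨?_, ?_, fun κ hκ => ?_⟩, ?_⟩
  · refine ((hi.const_mul (2 * p)).sub h.integrable).congr ?_
    filter_upwards [hζ.ae_mem] with z hz
    have h1 := (hζ.p_sub_ne hz).1
    rw [hshift z hz]
    simp only [Pi.sub_apply]
    field_simp
    ring
  · refine ((h.integrable_inv.const_mul 1).add (hi.const_mul 2)).congr ?_
    filter_upwards [hζ.ae_mem] with z hz
    rw [hshift' z hz]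
    rfl
  · have hj := Integrable.mul_one_div_add hζ hK hκ h.integrable
    have hκ' : p + κ ≠ 0 := fun e => (hK.ne κ hκ).2.2 (by linear_combination e)
    rw [integral_eq_linear_combination (h := fun z => weight p ζ m n x z *
      ((p - z.2) / (p + z.2) * R z.2) * (1 / (z.1 + κ))) hj hi hi hi ((p - κ) / (p + κ)) (2 * p / (p + κ)) 0 0]
    · linear_combination ((p - κ) / (p + κ)) * h.equation κ hκ
    · filter_upwards [hζ.ae_mem] with z hz
      have := hK.add_ne_zero hκ hz
      have h1 := (hζ.p_sub_ne hz).1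
      rw [hshift z hz]
      field_simp
      ring
  · unfold invMoment
    rw [integral_eq_linear_combination h.integrable_inv hi hi hi 1 2 0 0]
    · ring
    · filter_upwards [hζ.ae_mem] with z hz
      rw [hshift' z hz]
      ring

section solution

variable [SigmaFinite ζ.μ] (hζ : Admissible p ζ J) (hK : SpectralRange p ζ K)
  (hv : IsAdjointSolution p ζ J K v)
include hζ hK hv

/-- The four-term relation between the amplitudes at `n₁` and `n₁ - 1`. -/
theorem amplitude_relation (m n : ℤ) (hx : x ∈ J) (hτ : ∀ m n : ℤ, tau p ζ m n x ≠ 0) {A G : ℂ}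
    (hG : G = 2 * p + potential p ζ v 0 0 (m - 1) (n - 1) x - potential p ζ v 0 0 m (n - 1) x)
    (hne : tau p ζ m (n - 1) x / tau p ζ m n x +
      tau p ζ (m - 1) (n - 1) x / tau p ζ (m - 1) n x ≠ 0)
    (hA : A * (tau p ζ m (n - 1) x / tau p ζ m n x +
      tau p ζ (m - 1) (n - 1) x / tau p ζ (m - 1) n x) =
      G * (tau p ζ m (n - 1) x / tau p ζ m n x)) (hκ : κ ∈ K) :
    -κ * amplitude p v m (n - 1) x κ +
      (p - κ) / (p + κ) * (-κ * amplitude p v (m - 1) (n - 1) x κ) =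
    A * ((p - κ) / (p + κ) * amplitude p v (m - 1) n x κ) -
      (G - A) * amplitude p v m n x κ := by
  have hpκ : ∀ κ ∈ K, p + κ ≠ 0 := fun κ hκ e => (hK.ne κ hκ).2.2 (by linear_combination e)
  have hT : ∀ m, tau p ζ m (n - 1) x / tau p ζ m n x =
      1 - invMoment p ζ m n x (amplitude p v m n x) := fun m => by
    rw [tau_mul_invMoment hζ hK hv m n hx, mul_div_cancel_left₀ _ (hτ m n)]
  rw [hT m, hT (m - 1)] at hne hA
  have sV := isSolution_amplitude hζ hK hv m n hx
  obtain ⟨c₀, sW, iW⟩ := (isSolution_amplitude hζ hK hv (m - 1) n hx).sub_one_left hζ hK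
  obtain ⟨sY, iY⟩ := isSolution_sub_one_right hζ hK hv m n hx
  obtain ⟨sY', iY'⟩ := isSolution_sub_one_right hζ hK hv (m - 1) n hx
  obtain ⟨c₁, sQ, iQ⟩ := sY'.sub_one_left hζ hK
  obtain ⟨sN, iN⟩ := sV.linear_combination hζ hK sW 1 1
  obtain ⟨sP, iP⟩ := sY.linear_combination hζ hK sQ 1 1
  obtain ⟨sZ₀, iZ₀⟩ := sP.linear_combination hζ hK sV 1 G
  obtain ⟨sZ, iZ⟩ := sZ₀.linear_combination hζ hK sN 1 (-A)
  set u := potential p ζ v 0 0 m (n - 1) x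
  set u' := potential p ζ v 0 0 (m - 1) (n - 1) x
  set i₀ := invMoment p ζ m n x (amplitude p v m n x)
  set i₁ := invMoment p ζ (m - 1) n x (amplitude p v (m - 1) n x)
  set θ := u' + p - c₁ - A * (1 - c₀) with hθ
  have hZs : ∀ κ ∈ K, 1 * (1 * (1 * (-κ + u) +
      1 * ((p - κ) / (p + κ) * (-κ + u') - 2 * p / (p + κ) * c₁)) + G * 1) +
      -A * (1 * 1 + 1 * ((p - κ) / (p + κ) * 1 - 2 * p / (p + κ) * c₀)) =
      2 * p / (p + κ) * θ := fun κ hκ => by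
    have := hpκ κ hκ
    rw [hθ, hG]
    field_simp
    ring
  have hNs : ∀ κ ∈ K, 1 * 1 + 1 * ((p - κ) / (p + κ) * 1 - 2 * p / (p + κ) * c₀) =
      2 * p / (p + κ) * (1 - c₀) := fun κ hκ => by
    have := hpκ κ hκ
    field_simp
    ring
  have hθ0 : θ = 0 := by
    -- The combination (1 - c₀) Z - θ N has right-hand side zero, so it vanishes together with its
    -- 1/k-moment. By the choice of A this moment is θ times the sum of the two tau ratios. No
    -- division by 1 - c₀, which could vanish, is needed.
    obtain ⟨sU, iU⟩ := sZ.linear_combination hζ hK sN (1 - c₀) (-θ)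
    have h0 := (sU.eq_zero hζ hK hx (hτ m n) fun κ hκ => by
      rw [hZs κ hκ, hNs κ hκ]
      ring).2
    rw [iU, iZ, iZ₀, iP, iY, iQ, iY', iN, iW] at h0
    refine (mul_eq_zero.1 (?_ : θ * (1 - i₀ + (1 - i₁)) = 0)).resolve_right hne
    linear_combination h0 - (1 - c₀) * hA - (1 - c₀) * hG
  have h := (sZ.eq_zero hζ hK hx (hτ m n) fun κ hκ => by
    rw [hZs κ hκ, hθ0, mul_zero]).1 κ hκ
  linear_combination h

end solution

end DL

end

/-! ### Logarithm of τ, the n₁-equation, and failure of gauge equivalence. -/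

section

open Filter Topology

theorem exists_antiderivative {J : Set ℝ} (hJ : IsOpen J) (hJc : J.OrdConnected) (hne : J.Nonempty)
    {f : ℝ → ℂ} (hf : ContinuousOn f J) : ∃ F : ℝ → ℂ, ∀ x ∈ J, HasDerivAt F (f x) x := by
  obtain ⟨x₀, h₀⟩ := hne
  refine ⟨fun x => ∫ t in x₀..x, f t, fun x hx => ?_⟩
  exact intervalIntegral.integral_hasDerivAt_right
    (hf.mono (hJc.uIcc_subset h₀ hx)).intervalIntegrable
    (hf.stronglyMeasurableAtFilter hJ x hx) (hf.continuousAt (hJ.mem_nhds hx))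

theorem exists_logarithm {J : Set ℝ} (hJ : IsOpen J) (hJc : J.OrdConnected) (hne : J.Nonempty)
    {τ u : ℝ → ℂ} (hu : ContinuousOn u J) (hτ : ∀ x ∈ J, HasDerivAt τ (τ x * u x) x)
    (hτ0 : ∀ x ∈ J, τ x ≠ 0) :
    ∃ S : ℝ → ℂ, ∀ x ∈ J, HasDerivAt S (u x) x ∧ Complex.exp (S x) = τ x := by
  obtain ⟨F, hF⟩ := exists_antiderivative hJ hJc hne hu
  obtain ⟨x₀, h₀⟩ := hne
  -- The logarithm is continued along J by integrating u from a base point; τ exp(-S) then has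
  -- derivative 0 and equals 1 there.
  have hS : ∀ x ∈ J, HasDerivAt (fun x => Complex.log (τ x₀) + (F x - F x₀)) (u x) x :=
    fun x hx => ((hF x hx).sub_const _).const_add _
  refine ⟨_, fun x hx => ⟨hS x hx, ?_⟩⟩
  have hd : ∀ x ∈ J, HasDerivAt
      (fun x => τ x * Complex.exp (-(Complex.log (τ x₀) + (F x - F x₀)))) 0 x := fun x hx => by
    refine ((hτ x hx).mul (hS x hx).neg.cexp).congr_deriv ?_
    ring
  have hc := hJ.is_const_of_deriv_eq_zero hJc.isPreconnected
    (fun x hx => (hd x hx).differentiableAt.differentiableWithinAt)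
    (fun x hx => (hd x hx).deriv) hx h₀
  simp only [sub_self, add_zero] at hc
  rw [Complex.exp_neg, Complex.exp_neg, Complex.exp_log (hτ0 x₀ h₀), mul_inv_cancel₀ (hτ0 x₀ h₀),
    mul_inv_eq_one₀ (Complex.exp_ne_zero _)] at hc
  exact hc.symm

namespace DL

variable {p : ℂ} {ζ : SpectralMeasure} {J : Set ℝ} {K : Set ℂ}
  {v : ℤ → ℤ → ℝ → ℂ → ℤ → ℂ} {m n : ℤ} {x : ℝ} {κ : ℂ}

theorem adLaxB [SigmaFinite ζ.μ] (hζ : Admissible p ζ J) (hK : SpectralRange p ζ K)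
    (hv : IsAdjointSolution p ζ J K v) (hτ : ∀ m n : ℤ, ∀ x ∈ J, tau p ζ m n x ≠ 0)
    {S : LatticeFun} (hS : ∀ m n : ℤ, ∀ x ∈ J, Complex.exp (S m n x) = tau p ζ m n x)
    (hκ : κ ∈ K) :
    AdLaxB p J (potential p ζ v 0 0) S (fun m n x => v m n x κ 0) := by
  intro m n x hx h1 h2
  have hκ' := hK.ne κ hκ
  have hp : p + κ ≠ 0 := fun e => hκ'.2.2 (by linear_combination e)
  have hp' : p - κ ≠ 0 := fun e => hκ'.2.1 (by linear_combination -e)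
  have hv0 : ∀ m n, v m n x κ 0 = sigma p m n x κ * amplitude p v m n x κ := fun m n => by
    rw [amplitude, mul_div_cancel₀ _ (sigma_ne_zero hκ')]
  have hneg : (S m (n - 1) x - S (m - 1) (n - 1) x) - (S m n x - S (m - 1) n x) =
      -((S (m - 1) (n - 1) x - S m (n - 1) x) - (S (m - 1) n x - S m n x)) := by ring
  rw [hneg, Complex.exp_neg] at h2 ⊢
  set X := Complex.exp ((S (m - 1) (n - 1) x - S m (n - 1) x) - (S (m - 1) n x - S m n x)) with hX
  have hX0 : X ≠ 0 := Complex.exp_ne_zero _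
  rw [Complex.exp_sub, Complex.exp_sub, Complex.exp_sub, hS _ _ x hx, hS _ _ x hx, hS _ _ x hx,
    hS _ _ x hx] at hX
  have t1 := hτ m n x hx
  have t2 := hτ m (n - 1) x hx
  have t3 := hτ (m - 1) n x hx
  have hXe : tau p ζ (m - 1) (n - 1) x / tau p ζ (m - 1) n x =
      X * (tau p ζ m (n - 1) x / tau p ζ m n x) := by
    rw [hX]
    field_simp
  set G := 2 * p + potential p ζ v 0 0 (m - 1) (n - 1) x - potential p ζ v 0 0 m (n - 1) x with hG
  have hsum : tau p ζ m (n - 1) x / tau p ζ m n x +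
      tau p ζ (m - 1) (n - 1) x / tau p ζ (m - 1) n x =
      (1 + X) * (tau p ζ m (n - 1) x / tau p ζ m n x) := by
    rw [hXe]
    ring
  have h := amplitude_relation hζ hK hv m n hx (fun m n => hτ m n x hx) (A := G / (1 + X)) hG
    (by rw [hsum]; exact mul_ne_zero h1 (div_ne_zero t2 t1))
    (by rw [hsum, ← mul_assoc, div_mul_cancel₀ _ h1]) hκ
  -- The two exponentials are reciprocal, so the two coefficients of the Lax equation add up to G.
  have hB : G / (1 + X⁻¹) = G - G / (1 + X) := by
    have : X + 1 ≠ 0 := by rwa [add_comm]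
    field_simp
    ring
  rw [hB]
  simp only [hv0, sigma_sub_one_right hκ'.1, sigma_sub_one_left hp hp']
  linear_combination sigma p m n x κ * h

/-- The equation determines φ at n+1 from φ at n, but downwards in n it is a first-order linear ODE.
It can therefore be started with zero above n = 0 and solved recursively for n ≤ 0. -/
theorem exists_lax_solution (hJ : IsOpen J) (hJc : J.OrdConnected) (hne : J.Nonempty)
    {u S : LatticeFun} (hS : ∀ m n : ℤ, ∀ x ∈ J, HasDerivAt (S m n) (u m n x) x) :
    ∃ φ : LatticeFun, LaxA J u φ ∧ (∀ m n x, 0 < n → φ m n x = 0) ∧ ∀ m x, φ m 0 x ≠ 0 := by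
  -- Variation of constants, with integrating factor exp(S_{n+1} - S_n).
  have step : ∀ (m n : ℤ) (f : ℝ → ℂ), ContinuousOn f J → ∃ f' : ℝ → ℂ, ContinuousOn f' J ∧
      ∀ x ∈ J, HasDerivAt f' (f x + (u m (n + 1) x - u m n x) * f' x) x := by
    intro m n f hf
    have hc : ∀ n, ContinuousOn (S m n) J := fun n x hx =>
      (hS m n x hx).continuousAt.continuousWithinAt
    obtain ⟨H, hH⟩ := exists_antiderivative hJ hJc hne
      (f := fun x => Complex.exp (-(S m (n + 1) x - S m n x)) * f x)
      ((((hc (n + 1)).sub (hc n)).neg.cexp).mul hf)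
    have hd : ∀ x ∈ J, HasDerivAt (fun x => Complex.exp (S m (n + 1) x - S m n x) * H x)
        (f x + (u m (n + 1) x - u m n x) * (Complex.exp (S m (n + 1) x - S m n x) * H x)) x := by
      intro x hx
      refine (((hS m (n + 1) x hx).sub (hS m n x hx)).cexp.mul (hH x hx)).congr_deriv ?_
      have : Complex.exp (S m (n + 1) x - S m n x) * Complex.exp (-(S m (n + 1) x - S m n x)) = 1 := by
        rw [← Complex.exp_add, add_neg_cancel, Complex.exp_zero]
      simp only [Pi.sub_apply]
      linear_combination f x * this
    exact ⟨_, fun x hx => (hd x hx).continuousAt.continuousWithinAt, hd⟩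
  have h0 : ∀ m x, x ∈ J → HasDerivAt (fun x => Complex.exp (S m 1 x - S m 0 x))
      ((u m 1 x - u m 0 x) * Complex.exp (S m 1 x - S m 0 x)) x := fun m x hx =>
    ((hS m 1 x hx).sub (hS m 0 x hx)).cexp.congr_deriv (mul_comm _ _)
  choose F hFc hFd using step
  -- The index k stands for n = -k; continuity is carried along because the next integration needs
  -- it.
  let f : ℤ → ℕ → {f : ℝ → ℂ // ContinuousOn f J} := fun m k =>
    Nat.rec ⟨fun x => Complex.exp (S m 1 x - S m 0 x),
      fun x hx => (h0 m x hx).continuousAt.continuousWithinAt⟩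
      (fun k g => ⟨F m (-(k : ℤ) - 1) g.1 g.2, hFc _ _ _ _⟩) k
  refine ⟨fun m n x => if 0 < n then 0 else (f m (-n).toNat).1 x, fun m n x hx => ?_,
    fun m n x hn => if_pos hn, fun m x => by simp [f]⟩
  rcases lt_trichotomy n 0 with hn | rfl | hn
  · obtain ⟨k, rfl⟩ : ∃ k : ℕ, n = -(k : ℤ) - 1 := ⟨(-n - 1).toNat, by omega⟩
    have e1 : ¬ 0 < -(k : ℤ) - 1 := by omega
    have e2 : ¬ 0 < -(k : ℤ) - 1 + 1 := by omega
    have e3 : (-(-(k : ℤ) - 1)).toNat = k + 1 := by omega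
    have e4 : (-(-(k : ℤ) - 1 + 1)).toNat = k := by omega
    simp only [if_neg e1, if_neg e2, e3, e4]
    exact hFd m (-(k : ℤ) - 1) (f m k).1 (f m k).2 x hx
  · simpa [f] using h0 m x hx
  · have e : 0 < n + 1 := by omega
    simpa [hn, e] using hasDerivAt_const x (0 : ℂ)

/-- At n = 1 the function gφ is identically zero, so the adjoint equation there reads 0 = -g₀φ₀,
which is false. The second equations play no role, hence `B` and `B'` are arbitrary. -/
theorem not_gaugeEquivalent (hJ : IsOpen J) (hJc : J.OrdConnected) (hne : J.Nonempty)
    {u S : LatticeFun} (hS : ∀ m n : ℤ, ∀ x ∈ J, HasDerivAt (S m n) (u m n x) x)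
    (B B' : LatticeFun → Prop) : ¬ GaugeEquivalent J (LaxA J u) B (AdLaxA J u) B' := by
  rintro ⟨g, hg, hA, -⟩
  obtain ⟨φ, hφ, hφ0, hφ1⟩ := exists_lax_solution hJ hJc hne hS
  obtain ⟨x, hx⟩ := hne
  have h := (hA φ).1 hφ 0 1 x hx
  simp only [hφ0 0 1 _ one_pos, mul_zero, add_zero, sub_self] at h
  have := h.unique (hasDerivAt_const x 0)
  exact mul_ne_zero (hg 0 0 x hx).1 (hφ1 0 x) (neg_eq_zero.1 this)

end DL

end

theorem mainTheorem4 (p : ℂ) (ζ : DL.SpectralMeasure) [MeasureTheory.SigmaFinite ζ.μ]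
    (J : Set ℝ) (hJ_open : IsOpen J) (hJ_interval : J.OrdConnected) (hJ_nonempty : J.Nonempty)
    (hζ : DL.Admissible p ζ J)
    (hτ : ∀ m n : ℤ, ∀ x ∈ J, DL.tau p ζ m n x ≠ 0)
    (K : Set ℂ) (hK : DL.SpectralRange p ζ K)
    (v : ℤ → ℤ → ℝ → ℂ → ℤ → ℂ) (hv : DL.IsAdjointSolution p ζ J K v) :
    ∃ S : DL.LatticeFun,
      DL.IsInverseDerivative J (DL.tau p ζ) (DL.potential p ζ v 0 0) S ∧
      (∀ k' ∈ K,
        DL.AdLaxA J (DL.potential p ζ v 0 0) (fun m n x => v m n x k' 0) ∧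
        DL.AdLaxB p J (DL.potential p ζ v 0 0) S (fun m n x => v m n x k' 0)) ∧
      ¬ DL.GaugeEquivalent J
        (DL.LaxA J (DL.potential p ζ v 0 0)) (DL.LaxB p J (DL.potential p ζ v 0 0) S)
        (DL.AdLaxA J (DL.potential p ζ v 0 0)) (DL.AdLaxB p J (DL.potential p ζ v 0 0) S) := by
  have hlog : ∀ m n : ℤ, ∃ S : ℝ → ℂ, ∀ x ∈ J,
      HasDerivAt S (DL.potential p ζ v 0 0 m n x) x ∧ Complex.exp (S x) = DL.tau p ζ m n x :=
    fun m n => exists_logarithm hJ_open hJ_interval hJ_nonempty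
      (DL.continuousOn_potential hJ_open hζ hK hv m n (hτ m n))
      (fun x hx => DL.hasDerivAt_tau hJ_open hζ hK hv m n hx) (hτ m n)
  choose S hS using hlog
  have hSd : ∀ m n : ℤ, ∀ x ∈ J, HasDerivAt (S m n) (DL.potential p ζ v 0 0 m n x) x :=
    fun m n x hx => (hS m n x hx).1
  have hSe : ∀ m n : ℤ, ∀ x ∈ J, Complex.exp (S m n x) = DL.tau p ζ m n x :=
    fun m n x hx => (hS m n x hx).2
  exact ⟨S, ⟨hSd, hSe⟩,
    fun k' hk' => ⟨DL.adLaxA hJ_open hζ hK hv hτ hk', DL.adLaxB hζ hK hv hτ hSe hk'⟩,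
    DL.not_gaugeEquivalent hJ_open hJ_interval hJ_nonempty hSd _ _⟩
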